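/- Let $(R,\mathfrak m)$ be a Noetherian local ring and let $M$ be a finitely generated $R$-module with $\dim M=d$ and $\operatorname{depth} M=d-1$ (so $d\ge 1$). Let $J$ be a parameter ideal for $M$, i.e. $J=(x_1,\dots,x_d)R$ with $x_1,\dots,x_d\in\mathfrak m$ such that $M/JM$ has finite length. Then the function $n\mapsto\lambda(M/J^{n+1}M)$, where $\lambda$ denotes length over $R$, agrees for all large $n$ with a polynomial $P_J(M,X)\in\mathbb Q[X]$ of degree $d$, and if we write $$P_J(M,X)=\sum_{i=0}^{d}(-1)^i e_i(J,M)\binom{X+d-i}{d-i},$$ then $e_1(J,M)<0$. -/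

import Mathlib

open Polynomial Filter

noncomputable section

/-- The polynomials `binom(X + k, k) ∈ ℚ[X]`, `k = 0, 1, 2, …`. They are Mathlib's
`Polynomial.preHilbertPoly ℚ k 0`, and the `k`-th one has degree `k`. -/
def binomialSequence : Polynomial.Sequence ℚ where
  elems' k := preHilbertPoly ℚ k 0
  degree_eq' k := by
    have h : preHilbertPoly ℚ k 0 ≠ 0 := by
      rw [← leadingCoeff_ne_zero, leadingCoeff_preHilbertPoly]
      positivity
    rw [degree_eq_natDegree h, natDegree_preHilbertPoly]

theorem binomialSequence_eval (k n : ℕ) :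
    (binomialSequence k).eval (n : ℚ) = ((n + k).choose k : ℚ) :=
  preHilbertPoly_eq_choose_sub_add ℚ k (Nat.zero_le n)

/-- The basis `binom(X + k, k)`, `k = 0, 1, 2, …`, of the `ℚ`-vector space `ℚ[X]`. -/
def binomialBasis : Module.Basis ℕ ℚ ℚ[X] :=
  binomialSequence.basis fun i => (leadingCoeff_ne_zero.mpr (binomialSequence.ne_zero i)).isUnit

/-- The Hilbert coefficient `e_i(P)` of a polynomial `P` of degree `d`, that is, the coefficient in
`P = ∑_{i=0}^{d} (-1)^i e_i(P) binom(X + d - i, d - i)`; it is `0` for `i > d`. -/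
def hilbertCoeff (P : ℚ[X]) (i : ℕ) : ℚ :=
  if i ≤ P.natDegree then (-1) ^ i * binomialBasis.repr P (P.natDegree - i) else 0

/-- The defining expansion of the Hilbert coefficients. -/
theorem eq_sum_hilbertCoeff (P : ℚ[X]) :
    P = ∑ i ∈ Finset.range (P.natDegree + 1),
      ((-1) ^ i * hilbertCoeff P i) • binomialSequence (P.natDegree - i) := by
  have hmem : P ∈ Submodule.span ℚ (binomialBasis '' Set.Iic P.natDegree) := by
    have h := binomialSequence.span_degreeLE (m := P.natDegree)
      fun i _ => (leadingCoeff_ne_zero.mpr (binomialSequence.ne_zero i)).isUnit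
    have h' : (binomialBasis '' Set.Iic P.natDegree) =
        binomialSequence '' Set.Iic P.natDegree :=
      Set.image_congr fun i _ => binomialSequence.basis_eq_self _ i
    rw [h', h, mem_degreeLE]
    exact degree_le_natDegree
  have hsupp := binomialBasis.repr_support_subset_of_mem_span _ hmem
  conv_lhs => rw [← binomialBasis.linearCombination_repr P, Finsupp.linearCombination_apply,
    Finsupp.sum_of_support_subset _ (s := Finset.range (P.natDegree + 1))
      (fun j hj => Finset.mem_range.mpr (Nat.lt_succ_of_le (hsupp hj))) _ (by simp),
    ← Finset.sum_range_reflect]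
  refine Finset.sum_congr rfl fun i hi => ?_
  have hi' : i ≤ P.natDegree := Nat.lt_succ_iff.mp (Finset.mem_range.mp hi)
  have hb : binomialBasis (P.natDegree - i) = binomialSequence (P.natDegree - i) :=
    binomialSequence.basis_eq_self _ _
  rw [hilbertCoeff, if_pos hi', ← mul_assoc, ← mul_pow]
  simp [hb]

section Modules

variable (R : Type*) [CommRing R] (M : Type*) [AddCommGroup M] [Module R M]

/-- The depth of a module over a local ring: the supremum of the lengths of the `M`-regular
sequences in the maximal ideal. -/
def moduleDepth [IsLocalRing R] : ℕ∞ :=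
  ⨆ rs : {rs : List R //
    (∀ r ∈ rs, r ∈ IsLocalRing.maximalIdeal R) ∧ RingTheory.Sequence.IsRegular M rs},
    (rs.1.length : ℕ∞)

/-- `x_1, …, x_d` is a system of parameters for `M`: `d = dim M`, the `x_i` lie in the maximal
ideal, and `M / (x_1, …, x_d) M` has finite length. -/
def IsSystemOfParameters [IsLocalRing R] {d : ℕ} (x : Fin d → R) : Prop :=
  Module.supportDim R M = d ∧ (∀ i, x i ∈ IsLocalRing.maximalIdeal R) ∧
    Module.length R (M ⧸ (Ideal.span (Set.range x) • ⊤ : Submodule R M)) ≠ ⊤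

/-- A parameter ideal for `M`: an ideal generated by a system of parameters for `M`. -/
def IsParameterIdeal [IsLocalRing R] (J : Ideal R) : Prop :=
  ∃ (d : ℕ) (x : Fin d → R), IsSystemOfParameters R M x ∧ J = Ideal.span (Set.range x)

variable {R}

/-- `P` is the polynomial associated to `n ↦ λ(M / I^(n+1) M)`: for all large `n` this length is
finite and equal to `P(n)`. -/
def IsHilbertSamuelPolynomial (I : Ideal R) (P : ℚ[X]) : Prop :=
  ∀ᶠ n : ℕ in atTop, ∃ l : ℕ,
    Module.length R (M ⧸ (I ^ (n + 1) • ⊤ : Submodule R M)) = l ∧ P.eval (n : ℚ) = l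

theorem IsHilbertSamuelPolynomial.unique {I : Ideal R} {P Q : ℚ[X]}
    (hP : IsHilbertSamuelPolynomial M I P) (hQ : IsHilbertSamuelPolynomial M I Q) : P = Q := by
  obtain ⟨N, hN⟩ := eventually_atTop.mp (hP.and hQ)
  refine eq_of_infinite_eval_eq P Q (Set.Infinite.mono ?_
    ((Set.Ici_infinite N).image (Nat.cast_injective (R := ℚ)).injOn))
  rintro _ ⟨n, hn, rfl⟩
  obtain ⟨⟨l, hl, hl'⟩, k, hk, hk'⟩ := hN n hn
  have : l = k := by exact_mod_cast hl.symm.trans hk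
  simp [hl', hk', this]

open Classical in
/-- The polynomial `P_I(M, X)` associated to `n ↦ λ(M / I^(n+1) M)` (it is unique if it exists;
`0` if there is none). -/
def hilbertSamuelPolynomial (I : Ideal R) : ℚ[X] :=
  if h : ∃ P : ℚ[X], IsHilbertSamuelPolynomial M I P then h.choose else 0

/-- The Hilbert coefficient `e_i(I, M) = e_i(P_I(M, X))`; `e_1(I, M)` is the Chern number. -/
def hilbertSamuelCoeff (I : Ideal R) (i : ℕ) : ℚ :=
  hilbertCoeff (hilbertSamuelPolynomial M I) i

end Modules

end

/-! Write `r = d - 1`. Prime avoidance and the depth hypothesis give generators of `J` such that `J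
= I + (y)`, with `I` generated by an `M`-regular sequence of length `r`
(`exists_isWeaklyRegular_ofList_eq`). Put `N = M / I M`. Since the depth is exactly `r`, `y` is a
zero divisor on `N`; since `dim M = r + 1`, `N` has infinite length. Hence `k = λ(0 :_N y)` is
positive, and `e = λ(N / y N) - k` is positive too, being the eventual slope of `λ(N / y ^ n N)`
(`torsionLength_lt_cotorsionLength`).

The Hilbert function is then squeezed, with `B_i(n) = binom(n + i, i)`: `e B_{r+1}(n) + B_r(n) ≤ λ(M
/ J ^ (n+1) M) ≤ e B_{r+1}(n) + h B_r(n)`. So its polynomial is `e B_{r+1} + c B_r` plus terms of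
degree below `r`, with `c > 0`, and `e_1 = -c` (`hilbertCoeff_one_neg_of_bounds`).

The upper bound removes the generators of `I` one at a time (`length_quotient_sup_pow_le_choose`),
down to the linear bound for `λ(N / y ^ n N)`. For the lower bound, regular sequences are
quasi-regular, so `I ^ n M / I ^ (n+1) M` is a sum of copies of `N`. As "cokernel minus kernel" of
`y` is additive in lengths, it equals `e B_r(n)` on `M / I ^ (n+1) M` (`cotorsionLength_pow_eq`).
The increment of `λ(M / J ^ n M)` is at least this number plus the length of the `y`-torsion of `I ^
n M / I ^ (n+1) M`, and this torsion yields the extra `B_r` (`le_length_quotient_sup_pow`).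

That a polynomial exists at all is Hilbert–Serre, proved for families of modules with degree-one
operators and applied through the Rees algebra. -/

/-! ### Lengths of quotients, and of kernel and cokernel of multiplication by an element. -/

section Lengths

variable {R : Type*} [CommRing R] {M : Type*} [AddCommGroup M] [Module R M]

theorem LinearMap.length_ker_add_length_range {N : Type*} [AddCommGroup N] [Module R N]
    (f : M →ₗ[R] N) :
    Module.length R (LinearMap.ker f) + Module.length R (LinearMap.range f) =
      Module.length R M :=
  (Module.length_eq_add_of_exact (LinearMap.ker f).subtype f.rangeRestrict
    (Submodule.subtype_injective _) f.surjective_rangeRestrict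
    (by rw [LinearMap.exact_iff]; simp)).symm

/-- The lengths in a six-term exact sequence `0 → A → B → C → D → E → F → 0`. -/
theorem Module.length_six_term {A B C D E F : Type*} [AddCommGroup A] [Module R A]
    [AddCommGroup B] [Module R B] [AddCommGroup C] [Module R C] [AddCommGroup D] [Module R D]
    [AddCommGroup E] [Module R E] [AddCommGroup F] [Module R F]
    (f₁ : A →ₗ[R] B) (f₂ : B →ₗ[R] C) (f₃ : C →ₗ[R] D) (f₄ : D →ₗ[R] E) (f₅ : E →ₗ[R] F)
    (h₁ : Function.Injective f₁) (h₁₂ : Function.Exact f₁ f₂) (h₂₃ : Function.Exact f₂ f₃)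
    (h₃₄ : Function.Exact f₃ f₄) (h₄₅ : Function.Exact f₄ f₅) (h₅ : Function.Surjective f₅) :
    Module.length R A + Module.length R C + Module.length R E =
      Module.length R B + Module.length R D + Module.length R F := by
  have e₁ := f₁.length_ker_add_length_range
  have e₂ := f₂.length_ker_add_length_range
  have e₃ := f₃.length_ker_add_length_range
  have e₄ := f₄.length_ker_add_length_range
  have e₅ := f₅.length_ker_add_length_range
  rw [LinearMap.ker_eq_bot.mpr h₁, Module.length_bot, zero_add] at e₁
  rw [LinearMap.exact_iff.mp h₁₂] at e₂
  rw [LinearMap.exact_iff.mp h₂₃] at e₃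
  rw [LinearMap.exact_iff.mp h₃₄] at e₄
  rw [LinearMap.exact_iff.mp h₄₅, LinearMap.range_eq_top.mpr h₅, Module.length_top] at e₅
  rw [← e₁, ← e₂, ← e₃, ← e₄, ← e₅]
  abel

/-- The length of `(A + B) / A`, for submodules `A` and `B`. -/
noncomputable def relLength (A B : Submodule R M) : ℕ∞ := Module.length R (B.map A.mkQ)

theorem length_quotient_eq_relLength_add (A B : Submodule R M) :
    Module.length R (M ⧸ A) = relLength A B + Module.length R (M ⧸ (A ⊔ B)) := by
  have h := (Submodule.factor (le_sup_left : A ≤ A ⊔ B)).length_ker_add_length_range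
  rw [LinearMap.range_eq_top.mpr (Submodule.factor_surjective _), Module.length_top] at h
  have hk : LinearMap.ker (Submodule.factor (le_sup_left : A ≤ A ⊔ B)) = B.map A.mkQ := by
    refine (Submodule.ker_mapQ _ _ _ _).trans ?_
    rw [Submodule.comap_id, Submodule.map_sup, Submodule.mkQ_map_self, bot_sup_eq]
  rw [hk] at h
  exact h.symm

theorem length_quotient_anti {A B : Submodule R M} (h : A ≤ B) :
    Module.length R (M ⧸ B) ≤ Module.length R (M ⧸ A) :=
  Module.length_le_of_surjective (Submodule.factor h) (Submodule.factor_surjective h)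

theorem relLength_inf_left (A B : Submodule R M) : relLength (A ⊓ B) B = relLength A B := by
  have h : ((A ⊓ B).mkQ ∘ₗ B.subtype).ker = (A.mkQ ∘ₗ B.subtype).ker := by
    ext x; simp
  have e := ((Submodule.quotEquivOfEq _ _ h).symm ≪≫ₗ
    ((A ⊓ B).mkQ ∘ₗ B.subtype).quotKerEquivRange)
  have e' := (A.mkQ ∘ₗ B.subtype).quotKerEquivRange
  have h1 := (e'.symm ≪≫ₗ e).length_eq
  rw [LinearMap.range_comp, LinearMap.range_comp, Submodule.range_subtype] at h1
  exact h1.symm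

theorem relLength_add {A B C : Submodule R M} (hAB : A ≤ B) (hBC : B ≤ C) :
    relLength A C = relLength A B + relLength B C := by
  let g := (Submodule.factor hAB) ∘ₗ (C.map A.mkQ).subtype
  have h := g.length_ker_add_length_range
  have hr : g.range = C.map B.mkQ := by
    rw [LinearMap.range_comp, Submodule.range_subtype, ← Submodule.map_comp]
    rfl
  have hk : Module.length R g.ker = relLength A B := by
    have : g.ker.map (C.map A.mkQ).subtype = B.map A.mkQ := by
      rw [LinearMap.ker_comp, Submodule.map_comap_subtype]
      have hk : LinearMap.ker (Submodule.factor hAB) = B.map A.mkQ := by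
        refine (Submodule.ker_mapQ _ _ _ _).trans ?_
        rw [Submodule.comap_id]
      rw [hk]
      exact inf_eq_right.mpr (Submodule.map_mono hBC)
    rw [relLength, ← this]
    exact (Submodule.equivMapOfInjective _ (Submodule.subtype_injective _) _).length_eq
  rw [hr, hk] at h
  exact h.symm

/-- The length of the kernel of multiplication by `y` on `M`. -/
noncomputable def torsionLength (y : R) (M : Type*) [AddCommGroup M] [Module R M] : ℕ∞ :=
  Module.length R (LinearMap.ker (LinearMap.lsmul R M y))

/-- The length of the cokernel of multiplication by `y` on `M`. -/
noncomputable def cotorsionLength (y : R) (M : Type*) [AddCommGroup M] [Module R M] : ℕ∞ :=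
  Module.length R (M ⧸ LinearMap.range (LinearMap.lsmul R M y))

variable (y : R)

theorem LinearEquiv.torsionLength_eq {N : Type*} [AddCommGroup N] [Module R N]
    (e : M ≃ₗ[R] N) : torsionLength y M = torsionLength y N :=
  (e.ofSubmodules (LinearMap.ker (LinearMap.lsmul R M y)) (LinearMap.ker (LinearMap.lsmul R N y))
    (by
      rw [Submodule.map_equiv_eq_comap_symm]
      ext x
      change y • e.symm x = 0 ↔ y • x = 0
      rw [← map_smul, LinearEquiv.map_eq_zero_iff])).length_eq

theorem LinearEquiv.cotorsionLength_eq {N : Type*} [AddCommGroup N] [Module R N]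
    (e : M ≃ₗ[R] N) : cotorsionLength y M = cotorsionLength y N :=
  (Submodule.Quotient.equiv (LinearMap.range (LinearMap.lsmul R M y))
    (LinearMap.range (LinearMap.lsmul R N y)) e (by
      rw [Submodule.map_equiv_eq_comap_symm]
      ext x
      simp only [Submodule.mem_comap, LinearMap.mem_range, LinearMap.lsmul_apply]
      refine ⟨fun ⟨z, hz⟩ => ⟨e z, ?_⟩, fun ⟨z, hz⟩ => ⟨e.symm z, ?_⟩⟩
      · rw [← map_smul, hz]; simp
      · rw [← map_smul, hz]; simp)).length_eq

theorem torsionLength_pi (ι : Type*) [Fintype ι] :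
    torsionLength y (ι → M) = Fintype.card ι * torsionLength y M := by
  let e : LinearMap.ker (LinearMap.lsmul R (ι → M) y) ≃ₗ[R]
      (ι → LinearMap.ker (LinearMap.lsmul R M y)) :=
    { toFun := fun x i => ⟨x.1 i, congrFun (LinearMap.mem_ker.mp x.2) i⟩
      map_add' := fun _ _ => rfl
      map_smul' := fun _ _ => rfl
      invFun := fun x => ⟨fun i => x i, funext fun i => LinearMap.mem_ker.mp (x i).2⟩
      left_inv := fun _ => rfl
      right_inv := fun _ => rfl }
  rw [torsionLength, e.length_eq]
  simp [torsionLength]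

theorem cotorsionLength_pi (ι : Type*) [Fintype ι] :
    cotorsionLength y (ι → M) = Fintype.card ι * cotorsionLength y M := by
  classical
  have h : LinearMap.range (LinearMap.lsmul R (ι → M) y) =
      Submodule.pi Set.univ fun _ : ι => LinearMap.range (LinearMap.lsmul R M y) := by
    ext x
    simp only [LinearMap.mem_range, LinearMap.lsmul_apply, Submodule.mem_pi, Set.mem_univ,
      forall_const]
    refine ⟨fun ⟨z, hz⟩ i => ⟨z i, congrFun hz i⟩, fun hx => ?_⟩
    choose z hz using hx
    exact ⟨z, funext hz⟩
  rw [cotorsionLength, h, (Submodule.quotientPi _).length_eq]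
  simp [cotorsionLength]

/-- Multiplication by `y` on a short exact sequence: the snake lemma in terms of lengths. -/
theorem torsionLength_add_cotorsionLength_of_exact {A B C : Type*} [AddCommGroup A] [Module R A]
    [AddCommGroup B] [Module R B] [AddCommGroup C] [Module R C] (f : A →ₗ[R] B) (g : B →ₗ[R] C)
    (hf : Function.Injective f) (hfg : Function.Exact f g) (hg : Function.Surjective g) :
    torsionLength y A + torsionLength y C + cotorsionLength y B =
      torsionLength y B + cotorsionLength y A + cotorsionLength y C := by
  let a := LinearMap.lsmul R A y
  let b := LinearMap.lsmul R B y
  let c := LinearMap.lsmul R C y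
  have hab : f ∘ₗ a = b ∘ₗ f := by ext; simp [a, b]
  have hbc : g ∘ₗ b = c ∘ₗ g := by ext; simp [c, b]
  let F₁ : a.ker →ₗ[R] b.ker := f.restrict fun x hx => by
    rw [LinearMap.mem_ker] at hx ⊢
    rw [← LinearMap.comp_apply, ← hab, LinearMap.comp_apply, hx, map_zero]
  let F₂ : b.ker →ₗ[R] c.ker := g.restrict fun x hx => by
    rw [LinearMap.mem_ker] at hx ⊢
    rw [← LinearMap.comp_apply, ← hbc, LinearMap.comp_apply, hx, map_zero]
  let G₁ : (A ⧸ a.range) →ₗ[R] B ⧸ b.range := Submodule.mapQ _ _ f <| by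
    rintro _ ⟨x, rfl⟩
    exact ⟨f x, by rw [← LinearMap.comp_apply, ← hab, LinearMap.comp_apply]⟩
  let G₂ : (B ⧸ b.range) →ₗ[R] C ⧸ c.range := Submodule.mapQ _ _ g <| by
    rintro _ ⟨x, rfl⟩
    exact ⟨g x, by rw [← LinearMap.comp_apply, ← hbc, LinearMap.comp_apply]⟩
  have ha : Function.Exact a a.range.mkQ := LinearMap.exact_map_mkQ_range a
  have hb : Function.Exact b b.range.mkQ := LinearMap.exact_map_mkQ_range b
  have hc : Function.Exact c.ker.subtype c := LinearMap.exact_subtype_ker_map c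
  have hb' : Function.Exact b.ker.subtype b := LinearMap.exact_subtype_ker_map b
  let δ := SnakeLemma.δ' a b c f g hfg f g hfg hab hbc c.ker.subtype hc a.range.mkQ ha hg hf
  refine Module.length_six_term F₁ F₂ δ G₁ G₂ ?_ ?_ ?_ ?_ ?_ ?_
  · intro x x' h
    exact Subtype.ext (hf (congrArg Subtype.val h))
  · intro x
    refine ⟨fun h => ?_, ?_⟩
    · obtain ⟨z, hz⟩ := (hfg x.1).mp (congrArg Subtype.val h)
      refine ⟨⟨z, hf ?_⟩, Subtype.ext hz⟩
      rw [← LinearMap.comp_apply, hab, LinearMap.comp_apply, hz, map_zero]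
      exact x.2
    · rintro ⟨z, rfl⟩
      exact Subtype.ext ((hfg _).mpr ⟨z.1, rfl⟩)
  · exact SnakeLemma.exact_δ'_right a b c f g hfg f g hfg hab hbc b.ker.subtype hb'
      c.ker.subtype hc a.range.mkQ ha hg hf F₂ rfl (Submodule.subtype_injective _)
  · exact SnakeLemma.exact_δ'_left a b c f g hfg f g hfg hab hbc c.ker.subtype hc a.range.mkQ ha
      b.range.mkQ hb hg hf G₁ rfl (Submodule.mkQ_surjective _)
  · intro x
    obtain ⟨x, rfl⟩ := Submodule.mkQ_surjective _ x
    refine ⟨fun h => ?_, ?_⟩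
    · obtain ⟨z, hz⟩ := (Submodule.Quotient.mk_eq_zero _).mp (h : Submodule.Quotient.mk (g x) = 0)
      obtain ⟨w, rfl⟩ := hg z
      obtain ⟨v, hv⟩ := (hfg (x - b w)).mp (by
        rw [map_sub, ← LinearMap.comp_apply g b, hbc, LinearMap.comp_apply, hz, sub_self])
      refine ⟨Submodule.Quotient.mk v, ?_⟩
      refine (Submodule.Quotient.eq _).mpr ⟨-w, ?_⟩
      rw [hv, map_neg]; abel
    · rintro ⟨z, hz⟩
      obtain ⟨z, rfl⟩ := Submodule.mkQ_surjective _ z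
      rw [← hz]
      refine (Submodule.Quotient.mk_eq_zero _).mpr ?_
      rw [(hfg (f z)).mpr ⟨z, rfl⟩]
      exact zero_mem _
  · intro x
    obtain ⟨x, rfl⟩ := Submodule.mkQ_surjective _ x
    obtain ⟨z, rfl⟩ := hg x
    exact ⟨Submodule.Quotient.mk z, rfl⟩

/-- Left exactness of `0 :_• y`. It supplies the finiteness that allows cancellation in `ℕ∞`, where
the additive identity alone could read `⊤ = ⊤`. -/
theorem torsionLength_le_of_exact {A B C : Type*} [AddCommGroup A] [Module R A]
    [AddCommGroup B] [Module R B] [AddCommGroup C] [Module R C] (f : A →ₗ[R] B) (g : B →ₗ[R] C)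
    (hf : Function.Injective f) (hfg : Function.Exact f g) :
    torsionLength y B ≤ torsionLength y A + torsionLength y C := by
  let h := g ∘ₗ (LinearMap.ker (LinearMap.lsmul R B y)).subtype
  let F : LinearMap.ker (LinearMap.lsmul R A y) →ₗ[R] LinearMap.ker (LinearMap.lsmul R B y) :=
    f.restrict fun x hx => by
      rw [LinearMap.mem_ker, LinearMap.lsmul_apply] at hx ⊢
      rw [← map_smul, hx, map_zero]
  have hF : h.ker ≤ F.range := by
    intro x hx
    obtain ⟨z, hz⟩ := (hfg x.1).mp hx
    refine ⟨⟨z, hf ?_⟩, Subtype.ext hz⟩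
    rw [LinearMap.lsmul_apply, map_smul, hz, map_zero]
    exact x.2
  rw [torsionLength, ← h.length_ker_add_length_range]
  gcongr
  · exact (Module.length_le_of_injective (Submodule.inclusion hF)
      (Submodule.inclusion_injective _)).trans
      (Module.length_le_of_surjective F.rangeRestrict F.surjective_rangeRestrict)
  · refine Module.length_le_of_injective (Submodule.inclusion ?_) (Submodule.inclusion_injective _)
    rintro _ ⟨x, rfl⟩
    have := x.2
    rw [LinearMap.mem_ker, LinearMap.lsmul_apply] at this ⊢
    simp only [h, LinearMap.comp_apply, Submodule.subtype_apply]
    rw [← map_smul, this, map_zero]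

/-- The exact sequence `0 → M / (B : y) → M / B → M / (B + y M) → 0` in terms of lengths. -/
theorem length_quotient_eq_comap_add (B : Submodule R M) :
    Module.length R (M ⧸ B) = Module.length R (M ⧸ B.comap (LinearMap.lsmul R M y)) +
      Module.length R (M ⧸ (B ⊔ LinearMap.range (LinearMap.lsmul R M y))) := by
  rw [length_quotient_eq_relLength_add B (LinearMap.range (LinearMap.lsmul R M y))]
  congr 1
  have e := (B.mkQ ∘ₗ LinearMap.lsmul R M y).quotKerEquivRange.length_eq
  rw [LinearMap.range_comp, LinearMap.ker_comp, Submodule.ker_mkQ] at e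
  exact e.symm

theorem torsionLength_quotient (B : Submodule R M) :
    torsionLength y (M ⧸ B) = relLength B (B.comap (LinearMap.lsmul R M y)) := by
  have : (LinearMap.ker (LinearMap.lsmul R (M ⧸ B) y)) =
      (B.comap (LinearMap.lsmul R M y)).map B.mkQ := by
    refine Submodule.comap_injective_of_surjective B.mkQ_surjective ?_
    rw [Submodule.comap_map_mkQ]
    ext x
    have hle : y • x ∈ B ↔ x ∈ B ⊔ B.comap (LinearMap.lsmul R M y) := by
      rw [sup_eq_right.mpr fun z hz => by exact B.smul_mem y hz]; rfl
    rw [← hle]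
    exact (Submodule.Quotient.mk_eq_zero B (x := y • x))
  rw [torsionLength, this, relLength]

theorem cotorsionLength_quotient (B : Submodule R M) :
    cotorsionLength y (M ⧸ B) =
      Module.length R (M ⧸ (B ⊔ LinearMap.range (LinearMap.lsmul R M y))) := by
  have h : LinearMap.range (LinearMap.lsmul R (M ⧸ B) y) =
      (LinearMap.range (LinearMap.lsmul R M y)).map B.mkQ := by
    rw [← LinearMap.range_comp]
    have : B.mkQ ∘ₗ LinearMap.lsmul R M y = LinearMap.lsmul R (M ⧸ B) y ∘ₗ B.mkQ := by
      ext; simp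
    rw [this, LinearMap.range_comp, Submodule.range_mkQ, LinearMap.range_eq_map]
  rw [cotorsionLength, h]
  have e := (Submodule.quotEquivOfEq _ _ (show (((LinearMap.range (LinearMap.lsmul R M y)).map
    B.mkQ).mkQ ∘ₗ B.mkQ).ker = B ⊔ LinearMap.range (LinearMap.lsmul R M y) by
      rw [LinearMap.ker_comp, Submodule.ker_mkQ, Submodule.comap_map_mkQ]))
  have e' := LinearMap.quotKerEquivOfSurjective (((LinearMap.range (LinearMap.lsmul R M y)).map
    B.mkQ).mkQ ∘ₗ B.mkQ) (by
      rw [LinearMap.coe_comp]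
      exact (Submodule.mkQ_surjective _).comp (Submodule.mkQ_surjective _))
  exact (e'.symm ≪≫ₗ e).length_eq

end Lengths

/-! ### Regular sequences are quasi-regular. -/

section QuasiRegular

variable {R : Type*} [CommRing R] (M : Type*) [AddCommGroup M] [Module R M]

/-- `I ^ n M / I ^ (n + 1) M` is, through multiplication by suitable elements, a direct sum of `k`
copies of `M / I M`. -/
def IsGradedPiecePower (I : Ideal R) (n k : ℕ) : Prop :=
  ∃ (ι : Type) (_ : Fintype ι) (φ : (ι → M) →ₗ[R] M), Fintype.card ι = k ∧
    LinearMap.range φ = I ^ n • (⊤ : Submodule R M) ∧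
    ∀ m, φ m ∈ I ^ (n + 1) • (⊤ : Submodule R M) ↔ ∀ i, m i ∈ I • (⊤ : Submodule R M)

variable {M}

theorem map_mem_pow_succ_smul {I : Ideal R} {n : ℕ} {ι : Type*} [Fintype ι]
    (φ : (ι → M) →ₗ[R] M) (hφ : LinearMap.range φ ≤ I ^ n • (⊤ : Submodule R M)) (m : ι → M)
    (hm : ∀ i, m i ∈ I • (⊤ : Submodule R M)) : φ m ∈ I ^ (n + 1) • (⊤ : Submodule R M) := by
  classical
  rw [← Finset.univ_sum_single m, map_sum]
  refine Submodule.sum_mem _ fun i _ => ?_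
  have h : (I • (⊤ : Submodule R M)).map (φ ∘ₗ LinearMap.single R (fun _ => M) i) ≤
      I ^ (n + 1) • (⊤ : Submodule R M) := by
    rw [Submodule.map_smul'', pow_succ', Submodule.mul_smul]
    refine Submodule.smul_mono le_rfl ?_
    rw [Submodule.map_top, LinearMap.range_comp]
    exact (LinearMap.map_le_range).trans hφ
  exact h ⟨m i, hm i, rfl⟩

/-- A product of `n + 1` generators either involves `z` or lies in `I ^ (n + 1)`. All later
comparisons of powers of `I + (z)` with powers of `I` rest on this splitting. -/
theorem sup_span_singleton_pow_succ (I : Ideal R) (z : R) (n : ℕ) :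
    (I ⊔ Ideal.span {z}) ^ (n + 1) =
      Ideal.span {z} * (I ⊔ Ideal.span {z}) ^ n ⊔ I ^ (n + 1) := by
  refine le_antisymm ?_ (sup_le ?_ (Ideal.pow_right_mono le_sup_left _))
  · induction n with
    | zero => simp [sup_comm]
    | succ n ih =>
      conv_lhs => rw [pow_succ', Ideal.sup_mul]
      refine sup_le ?_ le_sup_left
      refine (Ideal.mul_mono_right ih).trans ?_
      rw [Ideal.mul_sup, mul_left_comm]
      refine sup_le_sup (Ideal.mul_mono_right ?_) (by rw [← pow_succ'])
      rw [pow_succ']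
      exact Ideal.mul_mono_left le_sup_left
  · rw [pow_succ']
    exact Ideal.mul_mono_left le_sup_right

theorem mem_sup_span_singleton_pow_succ_smul {I : Ideal R} {z : R} {n : ℕ} {x : M}
    (hx : x ∈ (I ⊔ Ideal.span {z}) ^ (n + 1) • (⊤ : Submodule R M)) :
    ∃ w ∈ (I ⊔ Ideal.span {z}) ^ n • (⊤ : Submodule R M),
      ∃ u ∈ I ^ (n + 1) • (⊤ : Submodule R M), z • w + u = x := by
  rw [sup_span_singleton_pow_succ, Submodule.sup_smul, Submodule.mul_smul,
    Submodule.ideal_span_singleton_smul, Submodule.mem_sup] at hx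
  obtain ⟨v, hv, u, hu, rfl⟩ := hx
  obtain ⟨w, hw, rfl⟩ := Submodule.mem_smul_pointwise_iff_exists _ _ _ |>.mp hv
  exact ⟨w, hw, u, hu, rfl⟩

theorem pow_smul_mono_right (I : Ideal R) {m n : ℕ} (h : m ≤ n) :
    I ^ n • (⊤ : Submodule R M) ≤ I ^ m • (⊤ : Submodule R M) :=
  Submodule.smul_mono_left (Ideal.pow_le_pow_right h)

/-- `z` is regular on `M / I M`, hence on each `I ^ n M / I ^ (n + 1) M`, a sum of copies of it; the
claim climbs the filtration one piece at a time. -/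
theorem mem_pow_smul_of_smul_mem {I : Ideal R} {z : R} {r : ℕ → ℕ}
    (hI : ∀ n, IsGradedPiecePower M I n (r n))
    (hz : ∀ m : M, z • m ∈ I • (⊤ : Submodule R M) → m ∈ I • (⊤ : Submodule R M)) (n : ℕ) (m : M)
    (hm : z • m ∈ I ^ n • (⊤ : Submodule R M)) : m ∈ I ^ n • (⊤ : Submodule R M) := by
  induction n generalizing m with
  | zero => simp
  | succ n ih =>
    obtain ⟨ι, _, φ, -, hr, hφ⟩ := hI n
    have h := ih m (pow_smul_mono_right I n.le_succ hm)
    rw [← hr] at h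
    obtain ⟨m, rfl⟩ := h
    rw [← map_smul, hφ] at hm
    exact (hφ m).mpr fun i => hz _ (hm i)

theorem mem_sup_pow_smul_of_smul_mem {I : Ideal R} {z : R} {r : ℕ → ℕ}
    (hI : ∀ n, IsGradedPiecePower M I n (r n))
    (hz : ∀ m : M, z • m ∈ I • (⊤ : Submodule R M) → m ∈ I • (⊤ : Submodule R M)) (n : ℕ) (m : M)
    (hm : z • m ∈ (I ⊔ Ideal.span {z}) ^ (n + 1) • (⊤ : Submodule R M)) :
    m ∈ (I ⊔ Ideal.span {z}) ^ n • (⊤ : Submodule R M) := by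
  obtain ⟨w, hw, u, hu, h⟩ := mem_sup_span_singleton_pow_succ_smul hm
  have h' : m - w ∈ I ^ (n + 1) • (⊤ : Submodule R M) := by
    refine mem_pow_smul_of_smul_mem hI hz _ _ ?_
    rwa [smul_sub, ← h, add_sub_cancel_left]
  have h'' : m - w ∈ (I ⊔ Ideal.span {z}) ^ n • (⊤ : Submodule R M) :=
    pow_smul_mono_right _ n.le_succ
      (Submodule.smul_mono_left (Ideal.pow_right_mono le_sup_left _) h')
  simpa using add_mem h'' hw

theorem isGradedPiecePower_zero (I : Ideal R) : IsGradedPiecePower M I 0 1 :=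
  ⟨Unit, inferInstance, LinearMap.proj (), rfl, by
    rw [pow_zero, Ideal.one_eq_top, Submodule.top_smul, LinearMap.range_eq_top]
    exact fun m => ⟨fun _ => m, rfl⟩, fun m => by
    rw [zero_add, pow_one]
    exact ⟨fun h _ => h, fun h => h ()⟩⟩

/-- Generators of degree `n + 1` are `z` times those of degree `n` for `I + (z)`, together with
those of degree `n + 1` for `I`; the count is Pascal's rule for `multichoose`. -/
theorem IsGradedPiecePower.sup_span_singleton {I : Ideal R} {z : R} {r : ℕ}
    (hI : ∀ n, IsGradedPiecePower M I n (r.multichoose n))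
    (hz : ∀ m : M, z • m ∈ I • (⊤ : Submodule R M) → m ∈ I • (⊤ : Submodule R M)) (n : ℕ) :
    IsGradedPiecePower M (I ⊔ Ideal.span {z}) n ((r + 1).multichoose n) := by
  induction n with
  | zero => simpa using isGradedPiecePower_zero _
  | succ n ih =>
    obtain ⟨ι₁, _, φ₁, hc₁, hr₁, hφ₁⟩ := ih
    obtain ⟨ι₂, _, φ₂, hc₂, hr₂, hφ₂⟩ := hI (n + 1)
    let φ : (ι₁ ⊕ ι₂ → M) →ₗ[R] M := z • φ₁ ∘ₗ LinearMap.funLeft R M Sum.inl +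
      φ₂ ∘ₗ LinearMap.funLeft R M Sum.inr
    have hφ (m) : φ m = z • φ₁ (m ∘ Sum.inl) + φ₂ (m ∘ Sum.inr) := rfl
    have hzI : z ∈ I ⊔ Ideal.span {z} := Ideal.mem_sup_right (Ideal.mem_span_singleton_self z)
    have hrange₁ : LinearMap.range φ ≤ (I ⊔ Ideal.span {z}) ^ (n + 1) • (⊤ : Submodule R M) := by
      rintro _ ⟨m, rfl⟩
      refine add_mem ?_ (Submodule.smul_mono_left (Ideal.pow_right_mono le_sup_left _)
        (hr₂ ▸ LinearMap.mem_range_self φ₂ _))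
      rw [pow_succ', Submodule.mul_smul]
      exact Submodule.smul_mem_smul hzI (hr₁ ▸ LinearMap.mem_range_self φ₁ _)
    refine ⟨ι₁ ⊕ ι₂, inferInstance, φ, ?_, le_antisymm hrange₁ ?_, fun m => ⟨fun hm => ?_,
      map_mem_pow_succ_smul φ hrange₁ m⟩⟩
    · rw [Fintype.card_sum, hc₁, hc₂, Nat.multichoose_succ_succ, add_comm]
    · intro x hx
      obtain ⟨w, hw, u, hu, rfl⟩ := mem_sup_span_singleton_pow_succ_smul hx
      rw [← hr₁] at hw
      rw [← hr₂] at hu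
      obtain ⟨w, rfl⟩ := hw
      obtain ⟨u, rfl⟩ := hu
      exact ⟨Sum.elim w u, rfl⟩
    · have h₂ : ∀ i, (m ∘ Sum.inr) i ∈ (I ⊔ Ideal.span {z}) • (⊤ : Submodule R M) := by
        obtain ⟨w, hw, u, hu, h⟩ := mem_sup_span_singleton_pow_succ_smul hm
        have h₁ : z • (w - φ₁ (m ∘ Sum.inl)) ∈ I ^ (n + 1) • (⊤ : Submodule R M) := by
          have : z • (w - φ₁ (m ∘ Sum.inl)) = φ₂ (m ∘ Sum.inr) - u := by
            rw [smul_sub, sub_eq_sub_iff_add_eq_add, h, hφ, add_comm]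
          rw [this]
          exact sub_mem (hr₂ ▸ LinearMap.mem_range_self φ₂ _) (pow_smul_mono_right I (by lia) hu)
        have h₃ := mem_pow_smul_of_smul_mem hI hz _ _ h₁
        rw [← hr₂] at h₃
        obtain ⟨v, hv⟩ := h₃
        have h₄ : φ₂ (m ∘ Sum.inr - z • v) ∈ I ^ (n + 1 + 1) • (⊤ : Submodule R M) := by
          have : φ₂ (m ∘ Sum.inr - z • v) = u := by
            rw [map_sub, map_smul, hv, smul_sub, ← add_sub_cancel_left (z • w) u, h, hφ]
            abel
          rwa [this]
        rw [hφ₂] at h₄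
        intro i
        rw [← sub_add_cancel ((m ∘ Sum.inr) i) (z • v i)]
        exact add_mem (Submodule.smul_mono_left le_sup_left (h₄ i))
          (Submodule.smul_mem_smul hzI trivial)
      have h₁ : ∀ i, (m ∘ Sum.inl) i ∈ (I ⊔ Ideal.span {z}) • (⊤ : Submodule R M) := by
        rw [← hφ₁]
        refine mem_sup_pow_smul_of_smul_mem hI hz _ _ ?_
        have := map_mem_pow_succ_smul φ₂ (n := n + 1) (I := I ⊔ Ideal.span {z})
          (hr₂.trans_le (Submodule.smul_mono_left (Ideal.pow_right_mono le_sup_left _))) _ h₂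
        rw [← add_sub_cancel_right (z • _) (φ₂ (m ∘ Sum.inr)), ← hφ]
        exact sub_mem hm this
      rintro (i | i)
      · exact h₁ i
      · exact h₂ i

/-- A regular sequence is quasi-regular. -/
theorem RingTheory.Sequence.IsWeaklyRegular.isGradedPiecePower {rs : List R}
    (h : RingTheory.Sequence.IsWeaklyRegular M rs) (n : ℕ) :
    IsGradedPiecePower M (Ideal.ofList rs) n (rs.length.multichoose n) := by
  induction rs using List.reverseRecOn generalizing n with
  | nil =>
    cases n with
    | zero => simpa using isGradedPiecePower_zero _
    | succ n =>
      refine ⟨Empty, inferInstance, 0, by simp, ?_, by simp⟩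
      rw [LinearMap.range_zero, Ideal.ofList_nil, Ideal.bot_pow n.succ_ne_zero,
        Submodule.bot_smul]
  | append_singleton rs z ih =>
    rw [RingTheory.Sequence.isWeaklyRegular_append_iff,
      RingTheory.Sequence.isWeaklyRegular_singleton_iff,
      isSMulRegular_quotient_iff_mem_of_smul_mem] at h
    rw [List.length_append, List.length_singleton, Ideal.ofList_append, Ideal.ofList_singleton]
    exact IsGradedPiecePower.sup_span_singleton (ih h.1) h.2 n

theorem IsGradedPiecePower.exists_linearEquiv {I : Ideal R} {n k : ℕ}
    (h : IsGradedPiecePower M I n k) : ∃ (ι : Type) (_ : Fintype ι), Fintype.card ι = k ∧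
      Nonempty ((I ^ n • (⊤ : Submodule R M)).map (I ^ (n + 1) • (⊤ : Submodule R M)).mkQ ≃ₗ[R]
        (ι → M ⧸ (I • ⊤ : Submodule R M))) := by
  obtain ⟨ι, _, φ, hc, hr, hφ⟩ := h
  refine ⟨ι, inferInstance, hc, ⟨?_⟩⟩
  have h₁ := ((I ^ (n + 1) • (⊤ : Submodule R M)).mkQ ∘ₗ φ).quotKerEquivRange
  rw [LinearMap.range_comp, hr] at h₁
  let ψ : (ι → M) →ₗ[R] (ι → M ⧸ (I • ⊤ : Submodule R M)) :=
    (I • ⊤ : Submodule R M).mkQ.compLeft ι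
  have hψ : Function.Surjective ψ := fun x => by
    choose m hm using fun i => Submodule.mkQ_surjective _ (x i)
    exact ⟨m, funext hm⟩
  refine h₁.symm ≪≫ₗ Submodule.quotEquivOfEq _ _ ?_ ≪≫ₗ ψ.quotKerEquivOfSurjective hψ
  ext m
  simp only [LinearMap.mem_ker, LinearMap.comp_apply, Submodule.mkQ_apply,
    Submodule.Quotient.mk_eq_zero, hφ, funext_iff, ψ, LinearMap.compLeft_apply,
    Function.comp_apply, Pi.zero_apply]

end QuasiRegular

/-! ### Upper bounds for the length of `M / J ^ n M`. -/

section Bounds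

variable {R : Type*} [CommRing R] {M : Type*} [AddCommGroup M] [Module R M]

/-- Multiplication by `x` carries `J ^ n M` into `J ^ (n + 1) M`, so `(A + J ^ (n + 1) M) : x`
contains `A + J ^ n M`. -/
theorem length_quotient_sup_pow_le {J : Ideal R} {x : R} (hx : x ∈ J) (A : Submodule R M) (n : ℕ) :
    Module.length R (M ⧸ (A ⊔ J ^ (n + 1) • ⊤ : Submodule R M)) ≤
      Module.length R (M ⧸ (A ⊔ J ^ n • ⊤ : Submodule R M)) +
        Module.length R (M ⧸ (A ⊔ LinearMap.range (LinearMap.lsmul R M x) ⊔ J ^ (n + 1) • ⊤ :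
          Submodule R M)) := by
  rw [length_quotient_eq_comap_add x, sup_right_comm]
  gcongr
  refine length_quotient_anti (sup_le (fun a ha => ?_) fun a ha => ?_)
  · exact Submodule.mem_sup_left (A.smul_mem x ha)
  · refine Submodule.mem_sup_right ?_
    rw [pow_succ', Submodule.mul_smul]
    exact Submodule.smul_mem_smul hx ha

theorem range_lsmul_le_smul_top {J : Ideal R} {x : R} (hx : x ∈ J) :
    LinearMap.range (LinearMap.lsmul R M x) ≤ J • ⊤ := by
  rintro _ ⟨m, rfl⟩
  exact Submodule.smul_mem_smul hx trivial

theorem span_singleton_smul_top_eq_range (x : R) :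
    Ideal.span {x} • (⊤ : Submodule R M) = LinearMap.range (LinearMap.lsmul R M x) := by
  ext m
  simp [Submodule.ideal_span_singleton_smul, Submodule.mem_smul_pointwise_iff_exists]

/-- Each generator in `L` is removed at the cost of one summation over `n`, which raises the
binomials by Pascal's rule. The summation starts at `n = 0`, where `x M ⊆ J M` makes the two
quotients equal. -/
theorem length_quotient_sup_pow_le_choose {J : Ideal R} (L : List R) (hL : ∀ x ∈ L, x ∈ J)
    (e h : ℕ) (A : Submodule R M)
    (hA : ∀ n : ℕ, Module.length R (M ⧸ (A ⊔ Ideal.ofList L • ⊤ ⊔ J ^ (n + 1) • ⊤ :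
      Submodule R M)) ≤ ((e * (n + 1) + h : ℕ) : ℕ∞)) (n : ℕ) :
    Module.length R (M ⧸ (A ⊔ J ^ (n + 1) • ⊤ : Submodule R M)) ≤
      ((e * (n + 1 + L.length).choose (L.length + 1) + h * (n + L.length).choose L.length : ℕ) :
        ℕ∞) := by
  induction L generalizing A n with
  | nil =>
    have := hA n
    rw [Ideal.ofList_nil, Submodule.bot_smul, sup_bot_eq] at this
    simpa using this
  | cons x L ih =>
    have hxJ : x ∈ J := hL x List.mem_cons_self
    have key := ih (fun z hz => hL z (List.mem_cons_of_mem _ hz))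
      (A ⊔ LinearMap.range (LinearMap.lsmul R M x)) (fun n => by
        refine le_trans (le_of_eq ?_) (hA n)
        rw [Ideal.ofList_cons, Submodule.sup_smul, span_singleton_smul_top_eq_range, sup_assoc A])
    rw [List.length_cons]
    induction n with
    | zero =>
      have h0 := key 0
      have : A ⊔ LinearMap.range (LinearMap.lsmul R M x) ⊔ J ^ (0 + 1) • ⊤ =
          A ⊔ J ^ (0 + 1) • ⊤ := by
        rw [zero_add, pow_one, sup_assoc, sup_eq_right (a := LinearMap.range _) |>.mpr
          (range_lsmul_le_smul_top hxJ)]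
      rw [this] at h0
      refine h0.trans (le_of_eq ?_)
      congr 2
      · rw [add_comm (0 + 1), zero_add, Nat.choose_self, add_comm 1, Nat.choose_self]
      · simp
    | succ n ihn =>
      refine (length_quotient_sup_pow_le hxJ A (n + 1)).trans ?_
      refine (add_le_add ihn (key (n + 1))).trans (le_of_eq ?_)
      rw [← Nat.cast_add]
      congr 1
      rw [show n + 1 + 1 + (L.length + 1) = (n + 1 + (L.length + 1)) + 1 by ring,
        show n + 1 + (L.length + 1) = (n + 1 + L.length) + 1 by ring,
        show n + 1 + 1 + L.length = n + 1 + L.length + 1 by ring,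
        show n + (L.length + 1) = n + 1 + L.length by ring,
        Nat.choose_succ_succ' (n + 1 + L.length + 1) (L.length + 1),
        Nat.choose_succ_succ' (n + 1 + L.length) L.length]
      ring

/-- All the `M / J ^ n M` have finite length as soon as `M / J M` has. -/
theorem length_quotient_pow_ne_top {J : Ideal R} (hfg : J.FG)
    (h : Module.length R (M ⧸ (J • ⊤ : Submodule R M)) ≠ ⊤) (n : ℕ) :
    Module.length R (M ⧸ (J ^ n • ⊤ : Submodule R M)) ≠ ⊤ := by
  obtain ⟨s, rfl⟩ := hfg
  obtain ⟨l, hl⟩ := ENat.ne_top_iff_exists.mp h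
  cases n with
  | zero =>
    rw [pow_zero, Ideal.one_eq_top, Submodule.top_smul, Module.length_eq_zero]
    exact ENat.zero_ne_top
  | succ n =>
    have hs : Ideal.ofList s.toList = Ideal.span (s : Set R) := by simp [Ideal.ofList]
    -- Here the list generates all of `J`, so the quotient in the hypothesis is bounded by `λ(M / J
    -- M) = l`: slope `0`, constant `l`.
    have := length_quotient_sup_pow_le_choose (M := M) (J := Ideal.span (s : Set R)) s.toList
      (fun x hx => Ideal.subset_span (by simpa using hx)) 0 l ⊥ (fun n => by
        rw [bot_sup_eq, hs]
        refine (length_quotient_anti le_sup_left).trans ?_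
        rw [← hl]; simp) n
    rw [bot_sup_eq] at this
    exact ne_top_of_le_ne_top (ENat.natCast_ne_top _) this

/-! ### Growth of the length of `M / y ^ n M`. -/

section Principal

variable (M) (y : R)

theorem comap_lsmul_range_pow_succ (n : ℕ) :
    (LinearMap.range (LinearMap.lsmul R M (y ^ (n + 1)))).comap (LinearMap.lsmul R M y) =
      LinearMap.range (LinearMap.lsmul R M (y ^ n)) ⊔ LinearMap.ker (LinearMap.lsmul R M y) := by
  refine le_antisymm ?_ (sup_le ?_ ?_)
  · rintro x ⟨z, hz⟩
    rw [← add_sub_cancel (y ^ n • z) x]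
    refine add_mem (Submodule.mem_sup_left ⟨z, rfl⟩) (Submodule.mem_sup_right ?_)
    rw [LinearMap.lsmul_apply, LinearMap.lsmul_apply] at hz
    rw [LinearMap.mem_ker, LinearMap.lsmul_apply, smul_sub, ← hz, smul_smul, pow_succ', sub_self]
  · rintro _ ⟨z, rfl⟩
    exact ⟨z, by rw [LinearMap.lsmul_apply, pow_succ', mul_smul]; rfl⟩
  · intro x hx
    rw [LinearMap.mem_ker] at hx
    rw [Submodule.mem_comap, hx]
    exact zero_mem _

theorem range_lsmul_pow_succ_le (n : ℕ) : LinearMap.range (LinearMap.lsmul R M (y ^ (n + 1))) ≤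
    LinearMap.range (LinearMap.lsmul R M (y ^ n)) := by
  rintro _ ⟨z, rfl⟩
  exact ⟨y • z, by rw [LinearMap.lsmul_apply, LinearMap.lsmul_apply, pow_succ, mul_smul]⟩

theorem length_quotient_range_pow_succ (n : ℕ) :
    Module.length R (M ⧸ LinearMap.range (LinearMap.lsmul R M (y ^ (n + 1)))) +
      relLength (LinearMap.range (LinearMap.lsmul R M (y ^ n)))
        (LinearMap.ker (LinearMap.lsmul R M y)) =
    Module.length R (M ⧸ LinearMap.range (LinearMap.lsmul R M (y ^ n))) + cotorsionLength y M := by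
  have h : LinearMap.range (LinearMap.lsmul R M (y ^ (n + 1))) ≤
      LinearMap.range (LinearMap.lsmul R M y) := by
    rintro _ ⟨z, rfl⟩
    exact ⟨y ^ n • z, by rw [LinearMap.lsmul_apply, LinearMap.lsmul_apply, pow_succ', mul_smul]⟩
  rw [length_quotient_eq_comap_add y, comap_lsmul_range_pow_succ, sup_eq_right.mpr h,
    length_quotient_eq_relLength_add (LinearMap.range (LinearMap.lsmul R M (y ^ n)))
      (LinearMap.ker (LinearMap.lsmul R M y)), cotorsionLength]
  abel

variable {M y}

theorem length_quotient_range_pow_ne_top (hc : cotorsionLength y M ≠ ⊤) (n : ℕ) :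
    Module.length R (M ⧸ LinearMap.range (LinearMap.lsmul R M (y ^ n))) ≠ ⊤ := by
  induction n with
  | zero =>
    have : LinearMap.range (LinearMap.lsmul R M (y ^ 0)) = ⊤ :=
      LinearMap.range_eq_top.mpr fun m => ⟨m, by simp⟩
    rw [this, Module.length_eq_zero]
    exact ENat.zero_ne_top
  | succ n ih =>
    exact ne_top_of_le_ne_top (WithTop.add_ne_top.mpr ⟨ih, hc⟩)
      (le_self_add.trans (length_quotient_range_pow_succ M y n).le)

variable (M y)

/-- The kernels of `y ^ n` stabilize; if `y` kills `y ^ n z`, then `z ∈ ker y ^ (n + 1) = ker y ^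
n`, so `y ^ n z = 0`. -/
theorem exists_disjoint_range_pow_ker [IsNoetherian R M] : ∃ K, ∀ n ≥ K,
    Disjoint (LinearMap.range (LinearMap.lsmul R M (y ^ n)))
      (LinearMap.ker (LinearMap.lsmul R M y)) := by
  let f : ℕ →o Submodule R M :=
    { toFun := fun n => LinearMap.ker (LinearMap.lsmul R M (y ^ n))
      monotone' := monotone_nat_of_le_succ fun n x hx => by
        rw [LinearMap.mem_ker, LinearMap.lsmul_apply] at hx ⊢
        rw [pow_succ', mul_smul, hx, smul_zero] }
  obtain ⟨K, hK⟩ := monotone_stabilizes_iff_noetherian.mpr ‹IsNoetherian R M› f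
  refine ⟨K, fun n hn => Submodule.disjoint_def.mpr ?_⟩
  rintro _ ⟨z, rfl⟩ hz
  have h : f (n + 1) = f n := (hK _ (hn.trans n.le_succ)).symm.trans (hK n hn)
  have hz' : z ∈ f (n + 1) := by
    rw [LinearMap.mem_ker, LinearMap.lsmul_apply, LinearMap.lsmul_apply, smul_smul,
      ← pow_succ'] at hz
    exact hz
  rw [h] at hz'
  exact hz'

variable {M y}

theorem relLength_eq_length_of_disjoint {A B : Submodule R M} (h : Disjoint A B) :
    relLength A B = Module.length R B := by
  rw [← relLength_inf_left, h.eq_bot]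
  exact (Submodule.equivMapOfInjective _ (LinearMap.ker_eq_bot.mp (by simp)) B).length_eq.symm

/-- For large `n`, `λ(M / y ^ n M)` is a linear function of `n` with slope the difference of the
lengths of the cokernel and of the kernel of `y`. -/
theorem exists_length_quotient_range_pow_succ [IsNoetherian R M] :
    ∃ K, ∀ n ≥ K, Module.length R (M ⧸ LinearMap.range (LinearMap.lsmul R M (y ^ (n + 1)))) +
      torsionLength y M =
      Module.length R (M ⧸ LinearMap.range (LinearMap.lsmul R M (y ^ n))) +
        cotorsionLength y M := by
  obtain ⟨K, hK⟩ := exists_disjoint_range_pow_ker M y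
  refine ⟨K, fun n hn => ?_⟩
  rw [torsionLength, ← relLength_eq_length_of_disjoint (hK n hn), length_quotient_range_pow_succ]

theorem torsionLength_ne_top [IsNoetherian R M] (hc : cotorsionLength y M ≠ ⊤) :
    torsionLength y M ≠ ⊤ := by
  obtain ⟨K, hK⟩ := exists_length_quotient_range_pow_succ (M := M) (y := y)
  exact ne_top_of_le_ne_top (WithTop.add_ne_top.mpr ⟨length_quotient_range_pow_ne_top hc K, hc⟩)
    (le_add_self.trans (hK K le_rfl).le)

/-- Otherwise `λ(M / y ^ n M)` does not grow from `K` to `K + 1`, so `y ^ K M = y ^ (K + 1) M`;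
Nakayama gives `y ^ K M = 0`, and `M` would have finite length. -/
theorem torsionLength_lt_cotorsionLength [IsNoetherian R M] (hc : cotorsionLength y M ≠ ⊤)
    (hy : y ∈ Ideal.jacobson (⊥ : Ideal R)) (hM : Module.length R M = ⊤) :
    torsionLength y M < cotorsionLength y M := by
  obtain ⟨K, hK⟩ := exists_length_quotient_range_pow_succ (M := M) (y := y)
  by_contra! hle
  have hfin := length_quotient_range_pow_ne_top hc
  have h1 : Module.length R (M ⧸ LinearMap.range (LinearMap.lsmul R M (y ^ (K + 1)))) ≤
      Module.length R (M ⧸ LinearMap.range (LinearMap.lsmul R M (y ^ K))) := by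
    have := hK K le_rfl
    have h2 : Module.length R (M ⧸ LinearMap.range (LinearMap.lsmul R M (y ^ (K + 1)))) +
      torsionLength y M ≤ Module.length R (M ⧸ LinearMap.range (LinearMap.lsmul R M (y ^ K))) +
        torsionLength y M := this.le.trans (add_le_add le_rfl hle)
    exact (ENat.add_le_add_iff_right (torsionLength_ne_top hc)).mp h2
  have h2 := length_quotient_eq_relLength_add (LinearMap.range (LinearMap.lsmul R M (y ^ (K + 1))))
    (LinearMap.range (LinearMap.lsmul R M (y ^ K)))
  rw [sup_eq_right.mpr (range_lsmul_pow_succ_le M y K)] at h2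
  have h3 : relLength (LinearMap.range (LinearMap.lsmul R M (y ^ (K + 1))))
    (LinearMap.range (LinearMap.lsmul R M (y ^ K))) = 0 := by
    rw [h2] at h1
    have : _ ≤ 0 + Module.length R (M ⧸ LinearMap.range (LinearMap.lsmul R M (y ^ K))) :=
      h1.trans_eq (zero_add _).symm
    exact nonpos_iff_eq_zero.mp ((ENat.add_le_add_iff_right (hfin K)).mp this)
  rw [relLength, Module.length_eq_zero_iff, Submodule.subsingleton_iff_eq_bot,
    ← le_bot_iff, Submodule.map_le_iff_le_comap, Submodule.comap_bot, Submodule.ker_mkQ] at h3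
  have h4 : LinearMap.range (LinearMap.lsmul R M (y ^ K)) ≤
      Ideal.span {y} • LinearMap.range (LinearMap.lsmul R M (y ^ K)) := by
    refine h3.trans ?_
    rintro _ ⟨z, rfl⟩
    rw [LinearMap.lsmul_apply, pow_succ', mul_smul]
    exact Submodule.smul_mem_smul (Ideal.mem_span_singleton_self y) ⟨z, rfl⟩
  have h5 := Submodule.eq_bot_of_le_smul_of_le_jacobson_bot _ _ (IsNoetherian.noetherian _) h4
    ((Ideal.span_singleton_le_iff_mem _).mpr hy)
  have h6 := hfin K
  rw [h5, (Submodule.quotEquivOfEqBot _ rfl).length_eq] at h6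
  exact h6 hM

/-- From the stable index `K` on, each step adds exactly `e`; below `K` the length is at most its
value at `K`. That value serves as `h`. -/
theorem exists_length_quotient_range_pow_le [IsNoetherian R M] (hc : cotorsionLength y M ≠ ⊤)
    {e : ℕ} (he : cotorsionLength y M = torsionLength y M + e) :
    ∃ h : ℕ, ∀ n, Module.length R (M ⧸ LinearMap.range (LinearMap.lsmul R M (y ^ n))) ≤
      ((e * n + h : ℕ) : ℕ∞) := by
  obtain ⟨K, hK⟩ := exists_length_quotient_range_pow_succ (M := M) (y := y)
  obtain ⟨h, hh⟩ := ENat.ne_top_iff_exists.mp (length_quotient_range_pow_ne_top hc K)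
  refine ⟨h, fun n => ?_⟩
  rcases le_total n K with hn | hn
  · have : LinearMap.range (LinearMap.lsmul R M (y ^ K)) ≤
        LinearMap.range (LinearMap.lsmul R M (y ^ n)) :=
      antitone_nat_of_succ_le (f := fun n => LinearMap.range (LinearMap.lsmul R M (y ^ n)))
        (range_lsmul_pow_succ_le M y) hn
    refine (length_quotient_anti this).trans ?_
    rw [← hh]
    exact_mod_cast Nat.le_add_left _ _
  · induction n, hn using Nat.le_induction with
    | base => rw [← hh]; exact_mod_cast Nat.le_add_left _ _
    | succ n hn ih =>
      have h1 := hK n hn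
      rw [he, add_comm (torsionLength y M), ← add_assoc] at h1
      rw [WithTop.add_right_cancel (torsionLength_ne_top hc) h1]
      refine (add_le_add ih le_rfl).trans (le_of_eq ?_)
      rw [← Nat.cast_add]
      congr 1
      ring

end Principal

/-! ### Lower bound for the length of `M / (I + (y)) ^ n M`. -/

section Lower

variable (M) (I : Ideal R) (y : R)

/-- The image of `I ^ n M` in `M / I ^ (n + 1) M`. -/
abbrev gradedPiece (n : ℕ) : Submodule R (M ⧸ (I ^ (n + 1) • ⊤ : Submodule R M)) :=
  (I ^ n • (⊤ : Submodule R M)).map (I ^ (n + 1) • (⊤ : Submodule R M)).mkQ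

theorem torsionLength_gradedPiece_add (n : ℕ) :
    torsionLength y (gradedPiece M I n) +
      torsionLength y (M ⧸ (I ^ n • ⊤ : Submodule R M)) +
      cotorsionLength y (M ⧸ (I ^ (n + 1) • ⊤ : Submodule R M)) =
    torsionLength y (M ⧸ (I ^ (n + 1) • ⊤ : Submodule R M)) +
      cotorsionLength y (gradedPiece M I n) +
      cotorsionLength y (M ⧸ (I ^ n • ⊤ : Submodule R M)) ∧
    torsionLength y (M ⧸ (I ^ (n + 1) • ⊤ : Submodule R M)) ≤
      torsionLength y (gradedPiece M I n) +
        torsionLength y (M ⧸ (I ^ n • ⊤ : Submodule R M)) := by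
  have hle : I ^ (n + 1) • (⊤ : Submodule R M) ≤ I ^ n • ⊤ := pow_smul_mono_right I n.le_succ
  have hex : Function.Exact (gradedPiece M I n).subtype (Submodule.factor hle) := by
    rw [LinearMap.exact_iff, Submodule.range_subtype]
    refine (Submodule.ker_mapQ _ _ _ _).trans ?_
    rw [Submodule.comap_id]
  exact ⟨torsionLength_add_cotorsionLength_of_exact y _ _ (Submodule.subtype_injective _) hex
    (Submodule.factor_surjective hle),
    torsionLength_le_of_exact y _ _ (Submodule.subtype_injective _) hex⟩

/-- If `y x = y w + u` with `w ∈ (I + (y)) ^ n M` and `u ∈ I ^ (n + 1) M`, then `x - w` is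
multiplied by `y` into `I ^ (n + 1) M`. -/
theorem comap_lsmul_sup_pow_succ (n : ℕ) :
    ((I ⊔ Ideal.span {y}) ^ (n + 1) • (⊤ : Submodule R M)).comap (LinearMap.lsmul R M y) =
      (I ⊔ Ideal.span {y}) ^ n • ⊤ ⊔
        (I ^ (n + 1) • (⊤ : Submodule R M)).comap (LinearMap.lsmul R M y) := by
  refine le_antisymm (fun x hx => ?_) (sup_le (fun x hx => ?_) (Submodule.comap_mono
    (Submodule.smul_mono_left (Ideal.pow_right_mono le_sup_left _))))
  · obtain ⟨w, hw, u, hu, h⟩ := mem_sup_span_singleton_pow_succ_smul hx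
    rw [← add_sub_cancel w x]
    refine add_mem (Submodule.mem_sup_left hw) (Submodule.mem_sup_right ?_)
    rw [Submodule.mem_comap, map_sub, ← h, LinearMap.lsmul_apply, add_sub_cancel_left]
    exact hu
  · rw [Submodule.mem_comap, pow_succ', Submodule.mul_smul]
    exact Submodule.smul_mem_smul
      (Ideal.mem_sup_right (Ideal.mem_span_singleton_self y)) hx

theorem sup_pow_succ_smul_sup_range (n : ℕ) :
    (I ⊔ Ideal.span {y}) ^ (n + 1) • (⊤ : Submodule R M) ⊔
        LinearMap.range (LinearMap.lsmul R M y) =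
      I ^ (n + 1) • ⊤ ⊔ LinearMap.range (LinearMap.lsmul R M y) := by
  refine le_antisymm (sup_le (fun x hx => ?_) le_sup_right) (sup_le_sup_right
    (Submodule.smul_mono_left (Ideal.pow_right_mono le_sup_left _)) _)
  obtain ⟨w, -, u, hu, rfl⟩ := mem_sup_span_singleton_pow_succ_smul hx
  exact add_mem (Submodule.mem_sup_right ⟨w, rfl⟩) (Submodule.mem_sup_left hu)

/-- The increment of `n ↦ λ(M / (I + y) ^ n M)`. -/
theorem le_length_quotient_sup_pow_succ (n : ℕ) :
    Module.length R (M ⧸ ((I ⊔ Ideal.span {y}) ^ n • ⊤ : Submodule R M)) +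
      cotorsionLength y (M ⧸ (I ^ (n + 1) • ⊤ : Submodule R M)) +
      torsionLength y (gradedPiece M I n) ≤
    Module.length R (M ⧸ ((I ⊔ Ideal.span {y}) ^ (n + 1) • ⊤ : Submodule R M)) +
      torsionLength y (M ⧸ (I ^ (n + 1) • ⊤ : Submodule R M)) := by
  set A : Submodule R M := (I ⊔ Ideal.span {y}) ^ n • ⊤
  set B : Submodule R M := I ^ (n + 1) • ⊤
  set D : Submodule R M := B.comap (LinearMap.lsmul R M y)
  have hBA : B ≤ A ⊓ D := le_inf ((pow_smul_mono_right I n.le_succ).trans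
    (Submodule.smul_mono_left (Ideal.pow_right_mono le_sup_left _)))
    fun x hx => B.smul_mem y hx
  -- The torsion `D / B` is cut along `A`: the part `D / (A ∩ D)` cancels against the same term in
  -- `λ(M / A)`, and the gain is `(A ∩ D) / B`.
  have h1 : torsionLength y (M ⧸ B) = relLength B (A ⊓ D) + relLength A D := by
    rw [torsionLength_quotient, relLength_add hBA inf_le_right, relLength_inf_left]
  -- This is the only inequality: since `I ^ n M ⊆ A`, the `y`-torsion of `I ^ n M / I ^ (n + 1) M`
  -- lies inside `(A ∩ D) / B`.
  have h2 : torsionLength y (gradedPiece M I n) ≤ relLength B (A ⊓ D) := by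
    refine Module.length_le_of_injective
      (((gradedPiece M I n).subtype ∘ₗ Submodule.subtype _).codRestrict _ ?_) ?_
    · rintro ⟨⟨_, x, hx, rfl⟩, hx'⟩
      refine ⟨x, ⟨Submodule.smul_mono_left (Ideal.pow_right_mono le_sup_left _) hx, ?_⟩, rfl⟩
      have := congrArg Subtype.val (LinearMap.mem_ker.mp hx')
      exact (Submodule.Quotient.mk_eq_zero B (x := y • x)).mp this
    · intro a b hab
      have := congrArg Subtype.val hab
      exact Subtype.ext (Subtype.ext this)
  rw [h1, length_quotient_eq_comap_add y ((I ⊔ Ideal.span {y}) ^ (n + 1) • ⊤),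
    comap_lsmul_sup_pow_succ, sup_pow_succ_smul_sup_range, ← cotorsionLength_quotient,
    length_quotient_eq_relLength_add A D]
  calc _ ≤ relLength A D + Module.length R (M ⧸ (A ⊔ D)) + cotorsionLength y (M ⧸ B) +
        relLength B (A ⊓ D) := by gcongr
    _ = _ := by abel

variable {M I y}

theorem IsGradedPiecePower.torsionLength_eq {n k : ℕ} (h : IsGradedPiecePower M I n k) :
    torsionLength y (gradedPiece M I n) =
      k * torsionLength y (M ⧸ (I • ⊤ : Submodule R M)) := by
  obtain ⟨ι, _, rfl, ⟨φ⟩⟩ := h.exists_linearEquiv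
  rw [φ.torsionLength_eq, torsionLength_pi]

theorem IsGradedPiecePower.cotorsionLength_eq {n k : ℕ} (h : IsGradedPiecePower M I n k) :
    cotorsionLength y (gradedPiece M I n) =
      k * cotorsionLength y (M ⧸ (I • ⊤ : Submodule R M)) := by
  obtain ⟨ι, _, rfl, ⟨φ⟩⟩ := h.exists_linearEquiv
  rw [φ.cotorsionLength_eq, cotorsionLength_pi]

/-- Cokernel minus kernel of `y` is additive along the `I`-adic filtration, and the piece of degree
`i` contributes `e * r.multichoose i`. The witness `l` avoids a subtraction in `ℕ∞`. -/
theorem cotorsionLength_pow_eq {r k e : ℕ}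
    (hI : ∀ n, IsGradedPiecePower M I n (r.multichoose n))
    (hk : torsionLength y (M ⧸ (I • ⊤ : Submodule R M)) = k)
    (hc : cotorsionLength y (M ⧸ (I • ⊤ : Submodule R M)) = k + e) (n : ℕ) :
    ∃ l : ℕ, torsionLength y (M ⧸ (I ^ (n + 1) • ⊤ : Submodule R M)) = l ∧
    cotorsionLength y (M ⧸ (I ^ (n + 1) • ⊤ : Submodule R M)) =
      (l + e * (r + 1).multichoose n : ℕ) := by
  induction n with
  | zero =>
    rw [zero_add, pow_one]
    exact ⟨k, hk, by simpa using hc⟩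
  | succ n ih =>
    obtain ⟨l, hl, hl'⟩ := ih
    obtain ⟨h₁, h₂⟩ := torsionLength_gradedPiece_add M I y (n + 1)
    rw [(hI (n + 1)).torsionLength_eq, hl, hk] at h₁ h₂
    rw [(hI (n + 1)).cotorsionLength_eq, hl', hc] at h₁
    obtain ⟨a, ha⟩ := ENat.ne_top_iff_exists.mp (ne_top_of_le_ne_top (by
      exact_mod_cast ENat.natCast_ne_top (r.multichoose (n + 1) * k + l)) h₂)
    refine ⟨a, ha.symm, ?_⟩
    rw [← ha] at h₁
    have h₃ : ((r.multichoose (n + 1) * k + l : ℕ) : ℕ∞) +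
        cotorsionLength y (M ⧸ (I ^ (n + 1 + 1) • ⊤ : Submodule R M)) =
        ((r.multichoose (n + 1) * k + l : ℕ) : ℕ∞) +
          (a + e * (r + 1).multichoose (n + 1) : ℕ) := by
      rw [Nat.multichoose_succ_succ]
      push_cast at h₁ ⊢
      rw [h₁]
      ring
    exact WithTop.add_left_cancel (ENat.natCast_ne_top _) h₃

/-- The increment is at least `e * (r + 1).multichoose n + k * r.multichoose n`. Using `k ≥ 1` and
summing gives the bound; the second term is what makes `e_1` negative. -/
theorem le_length_quotient_sup_pow {r k e : ℕ}
    (hI : ∀ n, IsGradedPiecePower M I n (r.multichoose n))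
    (hk : torsionLength y (M ⧸ (I • ⊤ : Submodule R M)) = k) (hk0 : 0 < k)
    (hc : cotorsionLength y (M ⧸ (I • ⊤ : Submodule R M)) = k + e) (n : ℕ) :
    ((e * (n + 1 + r).choose (r + 1) + (n + r).choose r : ℕ) : ℕ∞) ≤
      Module.length R (M ⧸ ((I ⊔ Ideal.span {y}) ^ (n + 1) • ⊤ : Submodule R M)) := by
  have hstep (n : ℕ) : Module.length R (M ⧸ ((I ⊔ Ideal.span {y}) ^ n • ⊤ : Submodule R M)) +
      (e * (r + 1).multichoose n + r.multichoose n : ℕ) ≤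
      Module.length R (M ⧸ ((I ⊔ Ideal.span {y}) ^ (n + 1) • ⊤ : Submodule R M)) := by
    have h := le_length_quotient_sup_pow_succ M I y n
    obtain ⟨l, hl, hl'⟩ := cotorsionLength_pow_eq hI hk hc n
    rw [hl, hl', (hI n).torsionLength_eq, hk] at h
    refine (ENat.add_le_add_iff_right (ENat.natCast_ne_top l)).mp (le_trans ?_ h)
    rw [add_assoc, add_assoc]
    refine add_le_add le_rfl ?_
    norm_cast
    have := Nat.le_mul_of_pos_right (r.multichoose n) hk0
    linarith
  have hsum (n : ℕ) : ((e * (r + 2).multichoose n + (r + 1).multichoose n : ℕ) : ℕ∞) ≤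
      Module.length R (M ⧸ ((I ⊔ Ideal.span {y}) ^ (n + 1) • ⊤ : Submodule R M)) := by
    induction n with
    | zero =>
      refine le_trans ?_ ((hstep 0).trans' le_add_self)
      simp
    | succ n ih =>
      refine le_trans ?_ (hstep (n + 1))
      refine le_trans (le_of_eq ?_) (add_le_add ih le_rfl)
      rw [← Nat.cast_add, Nat.multichoose_succ_succ, Nat.multichoose_succ_succ r]
      congr 1
      ring
  refine le_trans (le_of_eq ?_) (hsum n)
  rw [Nat.multichoose_eq, Nat.multichoose_eq]
  rw [show r + 2 + n - 1 = n + 1 + r by lia, show r + 1 + n - 1 = n + r by lia,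
    Nat.choose_symm_of_eq_add (show n + 1 + r = n + (r + 1) by ring),
    Nat.choose_symm_of_eq_add (show n + r = n + r from rfl)]

end Lower

end Bounds

/-! ### The Hilbert–Serre theorem for families with degree-one operators. -/

section HilbertSerre

theorem exists_polynomial_eval_succ_sub_eval (Q : ℚ[X]) :
    ∃ P : ℚ[X], ∀ n : ℕ, P.eval ((n : ℚ) + 1) - P.eval (n : ℚ) = Q.eval (n : ℚ) := by
  -- With `Q` evaluated at `n + 1`, Pascal's rule makes `B_{k+1}` an antidifference of `B_k`; the
  -- shift is undone at the end by composing with `X - 1`.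
  have key (Q : ℚ[X]) : ∃ P : ℚ[X], ∀ n : ℕ,
      P.eval ((n : ℚ) + 1) - P.eval (n : ℚ) = Q.eval ((n : ℚ) + 1) := by
    have hQ : Q ∈ Submodule.span ℚ (Set.range binomialBasis) := by
      rw [binomialBasis.span_eq]
      trivial
    induction hQ using Submodule.span_induction with
    | zero => exact ⟨0, by simp⟩
    | mem Q hQ =>
      obtain ⟨k, rfl⟩ := hQ
      refine ⟨binomialSequence (k + 1), fun n => ?_⟩
      have hk : binomialBasis k = binomialSequence k := binomialSequence.basis_eq_self _ _
      rw [hk, ← Nat.cast_succ, binomialSequence_eval, binomialSequence_eval,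
        binomialSequence_eval, sub_eq_iff_eq_add, ← Nat.cast_add, Nat.cast_inj,
        show n.succ + (k + 1) = n.succ + k + 1 by ring, Nat.choose_succ_succ']
      congr 2
      lia
    | add P Q _ _ hP hQ =>
      obtain ⟨P', hP⟩ := hP
      obtain ⟨Q', hQ⟩ := hQ
      refine ⟨P' + Q', fun n => ?_⟩
      simp only [eval_add]
      linarith [hP n, hQ n]
    | smul c P _ hP =>
      obtain ⟨P', hP⟩ := hP
      refine ⟨c • P', fun n => ?_⟩
      simp only [eval_smul, ← smul_sub, hP n]
  obtain ⟨P, hP⟩ := key (Q.comp (X - 1))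
  exact ⟨P, fun n => by simp [hP n]⟩

theorem exists_polynomial_of_eventually_succ_sub {a : ℕ → ℚ} {Q : ℚ[X]}
    (h : ∀ᶠ n : ℕ in atTop, a (n + 1) - a n = Q.eval (n : ℚ)) :
    ∃ P : ℚ[X], ∀ᶠ n : ℕ in atTop, a n = P.eval (n : ℚ) := by
  obtain ⟨P, hP⟩ := exists_polynomial_eval_succ_sub_eval Q
  obtain ⟨N, hN⟩ := eventually_atTop.mp h
  refine ⟨P + C (a N - P.eval (N : ℚ)), eventually_atTop.mpr ⟨N, fun n hn => ?_⟩⟩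
  induction n, hn using Nat.le_induction with
  | base => simp
  | succ n hn ih =>
    have h1 := hN n hn
    have h2 := hP n
    simp only [eval_add, eval_C, Nat.cast_succ] at ih ⊢
    linarith

variable {R : Type*} [CommRing R]

/-- A family of submodules of the pieces `G n` that is stable under operators of degree `1`. -/
def IsStableFamily {s : ℕ} {G : ℕ → Type*} [∀ n, AddCommGroup (G n)] [∀ n, Module R (G n)]
    (t : Fin s → ∀ n, G n →ₗ[R] G (n + 1)) (N : ∀ n, Submodule R (G n)) : Prop :=
  ∀ i n, N n ≤ (N (n + 1)).comap (t i n)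

/-- The graded submodules of `⨁ G n`, a module over a polynomial ring whose variables act by
the operators `t i`, satisfy the ascending chain condition. -/
def IsNoetherianFamily {s : ℕ} {G : ℕ → Type*} [∀ n, AddCommGroup (G n)] [∀ n, Module R (G n)]
    (t : Fin s → ∀ n, G n →ₗ[R] G (n + 1)) : Prop :=
  ∀ f : ℕ → ∀ n, Submodule R (G n), Monotone f → (∀ k, IsStableFamily t (f k)) →
    ∃ k₀, ∀ k ≥ k₀, f k = f k₀

theorem exists_subsingleton_of_isNoetherianFamily {G : ℕ → Type*} [∀ n, AddCommGroup (G n)]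
    [∀ n, Module R (G n)] {t : Fin 0 → ∀ n, G n →ₗ[R] G (n + 1)} (h : IsNoetherianFamily t) :
    ∃ N, ∀ n ≥ N, Subsingleton (G n) := by
  -- Without operators every family is stable, so the truncations below degree `k` form an
  -- admissible ascending chain.
  obtain ⟨k, hk⟩ := h (fun k n => if n < k then ⊤ else ⊥) (fun k l hkl n => by
    dsimp only
    split_ifs with h1 h2
    · exact le_rfl
    · exact absurd (h1.trans_le hkl) h2
    · exact bot_le
    · exact le_rfl) (fun _ i => i.elim0)
  refine ⟨k, fun n hn => ?_⟩
  have h2 := congrFun (hk (n + 1) (hn.trans n.le_succ)) n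
  simp only [Nat.lt_succ_self, if_true, not_lt.mpr hn, if_false] at h2
  exact (Submodule.subsingleton_iff R).mp (subsingleton_of_bot_eq_top h2.symm)

theorem length_toNat_sub_eq {A B : Type*} [AddCommGroup A] [Module R A]
    [AddCommGroup B] [Module R B] (f : A →ₗ[R] B) (hA : Module.length R A ≠ ⊤)
    (hB : Module.length R B ≠ ⊤) :
    ((Module.length R B).toNat : ℚ) - (Module.length R A).toNat =
      (Module.length R (B ⧸ LinearMap.range f)).toNat -
        (Module.length R (LinearMap.ker f)).toNat := by
  have h₁ := f.length_ker_add_length_range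
  have h₂ := Module.length_eq_add_of_exact (LinearMap.range f).subtype (LinearMap.range f).mkQ
    (Submodule.subtype_injective _) (Submodule.mkQ_surjective _)
    (LinearMap.exact_subtype_mkQ _)
  have hk : Module.length R (LinearMap.ker f) ≠ ⊤ := ne_top_of_le_ne_top hA (h₁ ▸ le_self_add)
  have hr : Module.length R (LinearMap.range f) ≠ ⊤ := ne_top_of_le_ne_top hA (h₁ ▸ le_add_self)
  have hc : Module.length R (B ⧸ LinearMap.range f) ≠ ⊤ :=
    ne_top_of_le_ne_top hB (h₂ ▸ le_add_self)
  rw [← h₁, h₂, ENat.toNat_add hk hr, ENat.toNat_add hr hc]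
  push_cast
  ring

/-- The Hilbert–Serre theorem: the length of the pieces of a Noetherian graded module over a
polynomial ring is eventually a polynomial. -/
theorem exists_polynomial_length_of_isNoetherianFamily (s : ℕ) {G : ℕ → Type*}
    [∀ n, AddCommGroup (G n)] [∀ n, Module R (G n)] (t : Fin s → ∀ n, G n →ₗ[R] G (n + 1))
    (hcomm : ∀ i j n x, t i (n + 1) (t j n x) = t j (n + 1) (t i n x))
    (hG : IsNoetherianFamily t) (hfin : ∀ n, Module.length R (G n) ≠ ⊤) :
    ∃ P : ℚ[X], ∀ᶠ n : ℕ in atTop, ((Module.length R (G n)).toNat : ℚ) = P.eval (n : ℚ) := by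
  induction s generalizing G with
  | zero =>
    obtain ⟨N, hN⟩ := exists_subsingleton_of_isNoetherianFamily hG
    refine ⟨0, eventually_atTop.mpr ⟨N, fun n hn => ?_⟩⟩
    have := hN n hn
    simp
  | succ s ih =>
    -- Kernel and cokernel of the last operator are acted on by the remaining `s`, and their lengths
    -- determine the increments of `λ(G n)`.
    let τ := t (Fin.last s)
    let K (n : ℕ) := LinearMap.ker (τ n)
    let tK (i : Fin s) (n : ℕ) : K n →ₗ[R] K (n + 1) :=
      (t i.castSucc n).restrict fun x hx => by
        rw [LinearMap.mem_ker] at hx ⊢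
        rw [hcomm, hx, map_zero]
    -- The cokernel is indexed so that its piece `n` is a quotient of `G (n + 1)`, matching the
    -- increment from `n` to `n + 1`.
    let tC (i : Fin s) (n : ℕ) : (G (n + 1) ⧸ LinearMap.range (τ n)) →ₗ[R]
        (G (n + 1 + 1) ⧸ LinearMap.range (τ (n + 1))) :=
      Submodule.mapQ _ _ (t i.castSucc (n + 1)) <| by
        rintro _ ⟨x, rfl⟩
        exact ⟨t i.castSucc n x, hcomm _ _ _ _⟩
    obtain ⟨P, hP⟩ := ih tK (fun i j n x => Subtype.ext (hcomm _ _ _ _)) (fun f hf hs => by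
      obtain ⟨k₀, hk₀⟩ := hG (fun k n => (f k n).map (K n).subtype)
        (fun k l hkl n => Submodule.map_mono (hf hkl n)) (fun k i n => by
          rintro _ ⟨x, hx, rfl⟩
          induction i using Fin.lastCases with
          | last =>
            rw [Submodule.mem_comap, show t (Fin.last s) n ((K n).subtype x) = 0 from x.2]
            exact zero_mem _
          | cast i => exact ⟨tK i n x, hs k i n hx, rfl⟩)
      exact ⟨k₀, fun k hk => funext fun n => Submodule.map_injective_of_injective
        (Submodule.subtype_injective _) (congrFun (hk₀ k hk) n)⟩)
      (fun n => ne_top_of_le_ne_top (hfin n)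
        (Module.length_le_of_injective _ (Submodule.subtype_injective _)))
    obtain ⟨Q, hQ⟩ := ih tC (fun i j n x => by
        obtain ⟨x, rfl⟩ := Submodule.mkQ_surjective _ x
        exact congrArg Submodule.Quotient.mk (hcomm _ _ _ _)) (fun f hf hs => by
      -- A chain in the cokernel is pulled back to `G`, with `⊥` in the degree `0` that the shift
      -- omits. The last operator preserves it because its image vanishes in the cokernel.
      let F (k : ℕ) : ∀ n, Submodule R (G n)
        | 0 => ⊥
        | n + 1 => (f k n).comap (LinearMap.range (τ n)).mkQ
      obtain ⟨k₀, hk₀⟩ := hG F (fun k l hkl n => by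
          cases n with
          | zero => exact le_rfl
          | succ n => exact Submodule.comap_mono (hf hkl n)) (fun k i n => by
          cases n with
          | zero => exact bot_le
          | succ n =>
            intro x hx
            induction i using Fin.lastCases with
            | last =>
              change (LinearMap.range (τ (n + 1))).mkQ (τ (n + 1) x) ∈ f k (n + 1)
              rw [Submodule.mkQ_apply, (Submodule.Quotient.mk_eq_zero _).mpr (LinearMap.mem_range_self _ _)]
              exact zero_mem _
            | cast i => exact hs k i n hx)
      exact ⟨k₀, fun k hk => funext fun n => Submodule.comap_injective_of_surjective
        (Submodule.mkQ_surjective _) (congrFun (hk₀ k hk) (n + 1))⟩)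
      (fun n => ne_top_of_le_ne_top (hfin (n + 1))
        (Module.length_le_of_surjective _ (Submodule.mkQ_surjective _)))
    refine exists_polynomial_of_eventually_succ_sub (Q := Q - P) ?_
    filter_upwards [hP, hQ] with n hP hQ
    rw [eval_sub, ← hP, ← hQ]
    exact length_toNat_sub_eq (τ n) (hfin n) (hfin (n + 1))

end HilbertSerre

/-! ### The Rees module and the Hilbert–Samuel polynomial. -/

section Adic

variable {R : Type*} [CommRing R] {M : Type*} [AddCommGroup M] [Module R M] (J : Ideal R)

/-- The ascending chain condition for homogeneous submodules of the Rees module `⨁ J ^ n M`. -/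
theorem exists_forall_eq_of_rees_chain [IsNoetherianRing R] [Module.Finite R M]
    (f : ℕ → ℕ → Submodule R M) (hf : Monotone f) (hle : ∀ k n, f k n ≤ J ^ n • ⊤)
    (hJ : ∀ k n, J • f k n ≤ f k (n + 1)) : ∃ k₀, ∀ k ≥ k₀, f k = f k₀ := by
  have hpow (k i j : ℕ) : J ^ i • f k j ≤ f k (i + j) := by
    induction i with
    | zero => simp
    | succ i ih =>
      rw [pow_succ', Submodule.mul_smul, add_right_comm]
      exact (Submodule.smul_mono le_rfl ih).trans (hJ _ _)
  let S (k : ℕ) : Submodule (reesAlgebra J) (PolynomialModule R M) :=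
    { carrier := { g | ∀ i, g.coeff i ∈ f k i }
      add_mem' := fun hf hg i => Submodule.add_mem _ (hf i) (hg i)
      zero_mem' := fun _ => Submodule.zero_mem _
      smul_mem' := fun r g hg i => by
        rw [Subalgebra.smul_def, PolynomialModule.smul_apply]
        apply Submodule.sum_mem
        rintro ⟨a, b⟩ e
        obtain rfl := Finset.HasAntidiagonal.mem_antidiagonal.mp e
        exact hpow k a b (Submodule.smul_mem_smul (r.2 a) (hg b)) }
  -- The full Rees module is finitely generated over the Noetherian Rees algebra, so the chain of
  -- the `S k` inside it stabilizes; monomials then recover `f k n` from `S k`.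
  let T := (J.stableFiltration (⊤ : Submodule R M)).submodule
  have hT : T.FG := ((J.stableFiltration (⊤ : Submodule R M)).submodule_fg_iff_stable
    fun i => IsNoetherian.noetherian _).mpr (J.stableFiltration_stable ⊤)
  have : IsNoetherian (reesAlgebra J) T := isNoetherian_of_fg_of_noetherian _ hT
  have hST (k) : S k ≤ T := fun g hg i => hle k i (hg i)
  obtain ⟨k₀, hk₀⟩ := monotone_stabilizes_iff_noetherian.mpr this
    ⟨fun k => (S k).comap T.subtype, fun k l hkl => Submodule.comap_mono
      fun g hg i => hf hkl i (hg i)⟩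
  refine ⟨k₀, fun k hk => ?_⟩
  have h := congrArg (Submodule.map T.subtype) (hk₀ k hk)
  change ((S k₀).comap T.subtype).map T.subtype = ((S k).comap T.subtype).map T.subtype at h
  rw [Submodule.map_comap_subtype, Submodule.map_comap_subtype, inf_eq_right.mpr (hST _),
    inf_eq_right.mpr (hST _)] at h
  have hle' : ∀ a b n, S a = S b → f a n ≤ f b n := fun a b n hab m hm => by
    have : PolynomialModule.single R n m ∈ S b := hab ▸ fun i => by
      rw [PolynomialModule.coeff_single, Finsupp.single_apply]
      split_ifs with hi
      · exact hi ▸ hm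
      · exact zero_mem _
    simpa [PolynomialModule.coeff_single] using this n
  exact funext fun n => le_antisymm (hle' _ _ n h.symm) (hle' _ _ n h)

/-- The function `n ↦ λ(M / J ^ (n + 1) M)` is eventually a polynomial. -/
theorem exists_isHilbertSamuelPolynomial [IsNoetherianRing R] [Module.Finite R M]
    (h : Module.length R (M ⧸ (J • ⊤ : Submodule R M)) ≠ ⊤) :
    ∃ P : ℚ[X], IsHilbertSamuelPolynomial M J P := by
  have hfin := length_quotient_pow_ne_top (M := M) (IsNoetherian.noetherian J) h
  let A (n : ℕ) : Submodule R M := J ^ n • ⊤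
  have hA (n) : A (n + 1) ≤ A n := pow_smul_mono_right J n.le_succ
  have hJA (n) (x) (hx : x ∈ J) (m) (hm : m ∈ A n) : x • m ∈ A (n + 1) := by
    change _ ∈ J ^ (n + 1) • (⊤ : Submodule R M)
    rw [pow_succ', Submodule.mul_smul]
    exact Submodule.smul_mem_smul hx hm
  let G (n : ℕ) := A n ⧸ (A (n + 1)).submoduleOf (A n)
  obtain ⟨s, x, hx⟩ := Submodule.fg_iff_exists_fin_generating_family.mp (IsNoetherian.noetherian J)
  have hxJ (i) : x i ∈ J := hx ▸ Submodule.subset_span ⟨i, rfl⟩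
  let t (i : Fin s) (n : ℕ) : G n →ₗ[R] G (n + 1) :=
    Submodule.mapQ _ _ ((LinearMap.lsmul R M (x i)).restrict (hJA n _ (hxJ i)))
      fun m hm => hJA (n + 1) _ (hxJ i) _ hm
  have hG : IsNoetherianFamily t := fun f hf hs => by
    obtain ⟨k₀, hk₀⟩ := exists_forall_eq_of_rees_chain J
      (fun k n => ((f k n).comap (Submodule.mkQ _)).map (A n).subtype)
      (fun k l hkl n => Submodule.map_mono (Submodule.comap_mono (hf hkl n)))
      (fun k n => by
        rintro _ ⟨m, -, rfl⟩
        exact m.2) (fun k n => by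
        conv_lhs => rw [← hx]
        rw [Submodule.span_smul_eq]
        refine Submodule.set_smul_le _ _ _ fun r m hr hm => ?_
        obtain ⟨i, rfl⟩ := hr
        obtain ⟨m, hm, rfl⟩ := hm
        exact ⟨_, hs k i n hm, rfl⟩)
    exact ⟨k₀, fun k hk => funext fun n => Submodule.comap_injective_of_surjective
      (Submodule.mkQ_surjective _) (Submodule.map_injective_of_injective
        (Submodule.subtype_injective _) (congrFun (hk₀ k hk) n))⟩
  have hlen (n) : relLength (A (n + 1)) (A n) = Module.length R (G n) := by
    have e := ((A (n + 1)).mkQ ∘ₗ (A n).subtype).quotKerEquivRange.length_eq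
    rw [LinearMap.range_comp, Submodule.range_subtype, LinearMap.ker_comp,
      Submodule.ker_mkQ] at e
    exact e.symm
  have hadd (n) : Module.length R (M ⧸ A (n + 1)) =
      Module.length R (G n) + Module.length R (M ⧸ A n) := by
    rw [length_quotient_eq_relLength_add (A (n + 1)) (A n), hlen, sup_eq_right.mpr (hA n)]
  have hGfin (n) : Module.length R (G n) ≠ ⊤ :=
    ne_top_of_le_ne_top (hfin (n + 1)) ((hadd n).symm ▸ le_self_add)
  obtain ⟨Q, hQ⟩ := exists_polynomial_length_of_isNoetherianFamily s t (fun i j n m => by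
      obtain ⟨m, rfl⟩ := Submodule.mkQ_surjective _ m
      exact congrArg Submodule.Quotient.mk (Subtype.ext (smul_comm _ _ _))) hG hGfin
  obtain ⟨P, hP⟩ := exists_polynomial_of_eventually_succ_sub
    (a := fun n => ((Module.length R (M ⧸ A n)).toNat : ℚ)) (Q := Q) (by
      filter_upwards [hQ] with n hn
      rw [hadd, ENat.toNat_add (hGfin n) (hfin n), ← hn]
      push_cast
      ring)
  -- `P` describes `λ(M / J ^ n M)`, whereas the Hilbert–Samuel polynomial is indexed by the
  -- exponent `n + 1`.
  refine ⟨P.comp (X + 1), ?_⟩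
  filter_upwards [(tendsto_add_atTop_nat 1).eventually hP] with n hn
  refine ⟨_, (ENat.natCast_toNat (hfin (n + 1))).symm, ?_⟩
  rw [hn]
  simp

end Adic

/-! ### Prime avoidance and regular elements in a coset. -/

section Avoidance

variable {R : Type*} [CommRing R]

/-- Prime avoidance for a coset: if the ideal `(x) + K` lies in none of finitely many primes, then
neither does some element of `x + K`. -/
theorem Ideal.exists_add_notMem_of_forall_not_le (x : R) (K : Ideal R) (S : Finset (Ideal R))
    (hS : ∀ p ∈ S, p.IsPrime) (h : ∀ p ∈ S, ¬ Ideal.span {x} ⊔ K ≤ p) :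
    ∃ k ∈ K, ∀ p ∈ S, x + k ∉ p := by
  classical
  induction hn : S.card generalizing S with
  | zero => exact ⟨0, K.zero_mem, by simp [Finset.card_eq_zero.mp hn]⟩
  | succ n ih =>
    -- Minimality of `p` ensures that no other member of `S` is contained in `p`, so `K` times their
    -- product contains some `b ∉ p`. Adding `b` repairs the situation at `p` without changing
    -- anything modulo the other primes.
    obtain ⟨p, hp⟩ := S.exists_minimal (Finset.card_pos.mp (by lia))
    have hpp := hS p hp.1
    obtain ⟨k, hk, hkS⟩ := ih (S.erase p) (fun q hq => hS q (Finset.mem_of_mem_erase hq))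
      (fun q hq => h q (Finset.mem_of_mem_erase hq)) (by rw [Finset.card_erase_of_mem hp.1]; lia)
    by_cases hxk : x + k ∈ p
    · have hKp : ¬ K ≤ p := fun hle => by
        have hx : x ∈ p := by simpa using p.sub_mem hxk (hle hk)
        exact h p hp.1 (sup_le ((Ideal.span_singleton_le_iff_mem p).mpr hx) hle)
      have hprod : ¬ K * ∏ q ∈ S.erase p, q ≤ p := by
        rw [hpp.mul_le, hpp.prod_le, not_or]
        refine ⟨hKp, fun ⟨q, hq, hqp⟩ => Finset.ne_of_mem_erase hq ?_⟩
        exact le_antisymm hqp (hp.2 (Finset.mem_of_mem_erase hq) hqp)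
      obtain ⟨b, hb, hbp⟩ := SetLike.not_le_iff_exists.mp hprod
      have hbK : b ∈ K := (Ideal.mul_le_left : K * ∏ q ∈ S.erase p, q ≤ K) hb
      have hbS : b ∈ ∏ q ∈ S.erase p, q :=
        (Ideal.mul_le_right : K * ∏ q ∈ S.erase p, q ≤ ∏ q ∈ S.erase p, q) hb
      refine ⟨k + b, K.add_mem hk hbK, fun q hq => ?_⟩
      rw [← add_assoc]
      by_cases hqp : q = p
      · subst hqp
        exact fun hmem => hbp (by simpa using q.sub_mem hmem hxk)
      · have hqS : q ∈ S.erase p := Finset.mem_erase.mpr ⟨hqp, hq⟩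
        have hbq : b ∈ q :=
          (Ideal.prod_le_inf.trans (Finset.inf_le (f := fun q => q) hqS)) hbS
        exact fun hmem => hkS q hqS (by simpa using q.sub_mem hmem hbq)
    · refine ⟨k, hk, fun q hq => ?_⟩
      by_cases hqp : q = p
      · exact hqp ▸ hxk
      · exact hkS q (Finset.mem_erase.mpr ⟨hqp, hq⟩)

variable [IsLocalRing R] {M : Type*} [AddCommGroup M] [Module R M]

open IsLocalRing

/-- A power of the maximal ideal annihilates a module of finite length. -/
theorem exists_maximalIdeal_pow_smul_eq_bot (h : Module.length R M ≠ ⊤) :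
    ∃ n, maximalIdeal R ^ n • (⊤ : Submodule R M) = ⊥ := by
  rw [Module.length_ne_top_iff, isFiniteLength_iff_isNoetherian_isArtinian] at h
  obtain ⟨_, _⟩ := h
  obtain ⟨n, hn⟩ := IsArtinian.monotone_stabilizes (R := R) (M := M)
    ⟨fun n => OrderDual.toDual (maximalIdeal R ^ n • (⊤ : Submodule R M)),
      fun _ _ hmn => pow_smul_mono_right _ hmn⟩
  have hn' : maximalIdeal R ^ n • (⊤ : Submodule R M) = maximalIdeal R ^ (n + 1) • ⊤ :=
    hn (n + 1) n.le_succ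
  refine ⟨n, Submodule.eq_bot_of_le_smul_of_le_jacobson_bot (maximalIdeal R) _
    (IsNoetherian.noetherian _) ?_ (maximalIdeal_le_jacobson ⊥)⟩
  rw [← Submodule.mul_smul, ← pow_succ', ← hn']

theorem le_of_mem_support_of_length_ne_top [Module.Finite R M] (h : Module.length R M ≠ ⊤)
    {p : PrimeSpectrum R} (hp : p ∈ Module.support R M) : maximalIdeal R ≤ p.asIdeal := by
  obtain ⟨n, hn⟩ := exists_maximalIdeal_pow_smul_eq_bot h
  rw [Module.mem_support_iff_of_finite] at hp
  refine p.2.le_of_pow_le (n := n) (le_trans (fun r hr => ?_) hp)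
  rw [Module.mem_annihilator]
  intro m
  rw [← Submodule.mem_bot R, ← hn]
  exact Submodule.smul_mem_smul hr trivial

theorem supportDim_le_zero_of_length_ne_top [Module.Finite R M] (h : Module.length R M ≠ ⊤) :
    Module.supportDim R M ≤ 0 := by
  have : Subsingleton (Module.support R M) := ⟨fun p q => Subtype.ext <| PrimeSpectrum.ext <|
    ((maximalIdeal.isMaximal R).eq_of_le p.1.2.ne_top
      (le_of_mem_support_of_length_ne_top h p.2)).symm.trans
    ((maximalIdeal.isMaximal R).eq_of_le q.1.2.ne_top
      (le_of_mem_support_of_length_ne_top h q.2))⟩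
  exact Order.krullDim_nonpos_of_subsingleton

/-- An associated prime containing `(x) + K` would lie in the support of a module of finite length,
hence contain the maximal ideal and with it the regular element `a`. So coset avoidance applies to
the associated primes. -/
theorem exists_isSMulRegular_add [IsNoetherianRing R] [Module.Finite R M] {x : R} {K : Ideal R}
    (hlen : Module.length R (M ⧸ ((Ideal.span {x} ⊔ K) • ⊤ : Submodule R M)) ≠ ⊤)
    {a : R} (ha : a ∈ maximalIdeal R) (hreg : IsSMulRegular M a) :
    ∃ k ∈ K, IsSMulRegular M (x + k) := by
  have hfin := associatedPrimes.finite R M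
  have hunion := biUnion_associatedPrimes_eq_compl_regular R M
  have key : ∀ p ∈ associatedPrimes R M, ¬ Ideal.span {x} ⊔ K ≤ p := fun p hp hle => by
    have hpp : p.IsPrime := hp.isPrime
    have hsupp : (⟨p, hpp⟩ : PrimeSpectrum R) ∈
        Module.support R (M ⧸ ((Ideal.span {x} ⊔ K) • ⊤ : Submodule R M)) := by
      rw [Module.support_quotient]
      refine ⟨?_, hle⟩
      exact Module.mem_support_iff_of_finite.mpr
        (Submodule.annihilator_top.symm.trans_le hp.annihilator_le)
    have ham : a ∈ p := le_of_mem_support_of_length_ne_top hlen hsupp ha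
    have : a ∈ {r : R | IsSMulRegular M r}ᶜ := hunion ▸ Set.mem_biUnion hp ham
    exact this hreg
  obtain ⟨k, hk, hkS⟩ := Ideal.exists_add_notMem_of_forall_not_le x K hfin.toFinset
    (fun p hp => ((hfin.mem_toFinset.mp hp).isPrime)) (fun p hp => key p (hfin.mem_toFinset.mp hp))
  refine ⟨k, hk, ?_⟩
  by_contra hnot
  have : x + k ∈ {r : R | IsSMulRegular M r}ᶜ := hnot
  rw [← hunion] at this
  obtain ⟨p, hp, hmem⟩ := Set.mem_iUnion₂.mp this
  exact hkS p (hfin.mem_toFinset.mpr hp) hmem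

end Avoidance

/-! ### Generators of a parameter ideal that begin with a regular sequence. -/

section Depth

universe u v

open IsLocalRing RingTheory.Sequence CategoryTheory Abelian

variable {R : Type u} [CommRing R] [IsLocalRing R] [IsNoetherianRing R]

/-- Depth drops by one modulo any regular `x`, which need not belong to the given sequence. Hence
the detour through vanishing of `Ext`, transferred by the long exact sequence of `0 → M → M → M / x
M → 0`. -/
theorem exists_isRegular_quotSMulTop {M : Type (max u v)} [AddCommGroup M] [Module R M]
    [Module.Finite R M] {n : ℕ} (h : ∃ rs : List R, rs.length = n + 1 ∧
      (∀ r ∈ rs, r ∈ maximalIdeal R) ∧ IsRegular M rs) {x : R} (hx : x ∈ maximalIdeal R)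
    (hreg : IsSMulRegular M x) : ∃ rs : List R, rs.length = n ∧
      (∀ r ∈ rs, r ∈ maximalIdeal R) ∧ IsRegular (QuotSMulTop x M) rs := by
  have hM : Nontrivial M := let ⟨_, _, _, h⟩ := h; h.nontrivial
  have hlt (N : Type (max u v)) [AddCommGroup N] [Module R N] [Module.Finite R N]
      [Nontrivial N] : maximalIdeal R • (⊤ : Submodule R N) < ⊤ := by
    refine lt_top_iff_ne_top.mpr (Ne.symm ?_)
    refine Submodule.top_ne_ideal_smul_of_le_jacobson_annihilator ?_
    exact (IsLocalRing.maximalIdeal_le_jacobson _)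
  have : Nontrivial (QuotSMulTop x M) := nontrivial_quotSMulTop_of_mem_maximalIdeal M hx
  have hext := ((ModuleCat.exists_isRegular_tfae.{max u v} (maximalIdeal R) (n + 1)
    (ModuleCat.of R M) (hlt M)).out 3 1).mp h
  refine ((ModuleCat.exists_isRegular_tfae.{max u v} (maximalIdeal R) n
    (ModuleCat.of R (QuotSMulTop x M)) (hlt _)).out 1 3).mp fun i hi => ?_
  have h₁ := AddCommGrpCat.isZero_of_iff_subsingleton.mpr (hext i (by lia))
  have h₂ := AddCommGrpCat.isZero_of_iff_subsingleton.mpr (hext (i + 1) (by lia))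
  exact AddCommGrpCat.subsingleton_of_isZero <| ShortComplex.Exact.isZero_of_both_zeros
    ((Ext.covariant_sequence_exact₃' _
      (IsSMulRegular.smulShortComplex_shortExact (M := ModuleCat.of R M) hreg)) i (i + 1) rfl)
    (h₁.eq_zero_of_src _) (h₂.eq_zero_of_tgt _)

/-- The first generator `x` is replaced by a regular `x + k`, with `k` in the ideal of the others,
which leaves the ideal unchanged; induction continues on `M / (x + k) M`. -/
theorem exists_isWeaklyRegular_ofList_eq_aux {n : ℕ} {L : List R} (hL : L.length = n + 1)
    (hLm : ∀ x ∈ L, x ∈ maximalIdeal R) {M : Type (max u v)} [AddCommGroup M] [Module R M]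
    [Module.Finite R M]
    (hlen : Module.length R (M ⧸ (Ideal.ofList L • ⊤ : Submodule R M)) ≠ ⊤)
    (h : ∃ rs : List R, rs.length = n ∧
      (∀ r ∈ rs, r ∈ maximalIdeal R) ∧ IsRegular M rs) :
    ∃ (rs : List R) (y : R), rs.length = n ∧ IsWeaklyRegular M rs ∧
      Ideal.ofList rs ⊔ Ideal.span {y} = Ideal.ofList L := by
  induction n generalizing L M with
  | zero =>
    obtain ⟨y, rfl⟩ := List.length_eq_one_iff.mp hL
    exact ⟨[], y, rfl, IsWeaklyRegular.nil R M, by simp⟩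
  | succ n ih =>
    obtain ⟨x, L, rfl⟩ := List.exists_cons_of_length_eq_add_one hL
    obtain ⟨a, ha, hareg⟩ : ∃ a ∈ maximalIdeal R, IsSMulRegular M a := by
      obtain ⟨rs, hrs, hmem, hreg⟩ := h
      obtain ⟨a, rs, rfl⟩ := List.exists_cons_of_length_eq_add_one hrs
      exact ⟨a, hmem a List.mem_cons_self, ((isRegular_cons_iff M a rs).mp hreg).1⟩
    have hlen' := hlen
    rw [Ideal.ofList_cons] at hlen'
    obtain ⟨k, hk, hreg⟩ := exists_isSMulRegular_add hlen' ha hareg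
    have hkm : k ∈ maximalIdeal R := (Ideal.span_le.mpr fun z hz =>
      hLm z (List.mem_cons_of_mem _ hz) : Ideal.ofList L ≤ maximalIdeal R) hk
    have hxk : x + k ∈ maximalIdeal R := add_mem (hLm x List.mem_cons_self) hkm
    have hspan : Ideal.ofList ((x + k) :: L) = Ideal.ofList (x :: L) := by
      rw [Ideal.ofList_cons, Ideal.ofList_cons]
      refine le_antisymm (sup_le ?_ le_sup_right) (sup_le ?_ le_sup_right) <;>
        rw [Ideal.span_singleton_le_iff_mem]
      · exact add_mem (Ideal.mem_sup_left (Ideal.mem_span_singleton_self x))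
          (Ideal.mem_sup_right hk)
      · have := sub_mem (Ideal.mem_sup_left (Ideal.mem_span_singleton_self (x + k)))
          (Ideal.mem_sup_right hk : k ∈ Ideal.span {x + k} ⊔ Ideal.ofList L)
        rwa [add_sub_cancel_right] at this
    rw [← hspan, (Submodule.quotOfListConsSMulTopEquivQuotSMulTopInner M (x + k) L).length_eq]
      at hlen
    obtain ⟨rs, y, hrs, hrsreg, hy⟩ := ih (L := L) (by simpa using hL)
      (fun z hz => hLm z (List.mem_cons_of_mem _ hz)) hlen (exists_isRegular_quotSMulTop h hxk hreg)
    refine ⟨(x + k) :: rs, y, by simp [hrs], (isWeaklyRegular_cons_iff M _ _).mpr ⟨hreg, hrsreg⟩, ?_⟩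
    rw [← hspan, Ideal.ofList_cons, Ideal.ofList_cons, sup_assoc, hy]

/-- An ideal with `n + 1` generators in the maximal ideal that is primary to the maximal ideal on
`M` has generators the first `n` of which are an `M`-regular sequence, if the maximal ideal
contains an `M`-regular sequence of length `n`. -/
theorem exists_isWeaklyRegular_ofList_eq {n : ℕ} {L : List R} (hL : L.length = n + 1)
    (hLm : ∀ x ∈ L, x ∈ maximalIdeal R) {M : Type v} [AddCommGroup M] [Module R M]
    [Module.Finite R M]
    (hlen : Module.length R (M ⧸ (Ideal.ofList L • ⊤ : Submodule R M)) ≠ ⊤)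
    (h : ∃ rs : List R, rs.length = n ∧
      (∀ r ∈ rs, r ∈ maximalIdeal R) ∧ IsRegular M rs) :
    ∃ (rs : List R) (y : R), rs.length = n ∧ IsWeaklyRegular M rs ∧
      Ideal.ofList rs ⊔ Ideal.span {y} = Ideal.ofList L := by
  let e : ULift.{u} M ≃ₗ[R] M := ULift.moduleEquiv
  obtain ⟨rs, y, h₁, h₂, h₃⟩ := exists_isWeaklyRegular_ofList_eq_aux.{u, v} hL hLm
    (M := ULift.{u} M) (by
      rwa [(Submodule.Quotient.equiv _ (Ideal.ofList L • ⊤ : Submodule R M) e (by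
        rw [Submodule.map_smul'', Submodule.map_top, LinearEquiv.range])).length_eq])
    (by
      obtain ⟨rs, hrs, hm, hreg⟩ := h
      exact ⟨rs, hrs, hm, (e.isRegular_congr rs).mpr hreg⟩)
  exact ⟨rs, y, h₁, (e.isWeaklyRegular_congr rs).mp h₂, h₃⟩

end Depth

/-! ### Reading `e_1` off from bounds on a polynomial. -/

section HilbertCoefficients

theorem Polynomial.leadingCoeff_nonneg_of_eventually_eval_nonneg {S : ℚ[X]}
    (h : ∀ᶠ n : ℕ in atTop, 0 ≤ S.eval (n : ℚ)) : 0 ≤ S.leadingCoeff := by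
  by_contra! hneg
  have hev : ∀ᶠ n : ℕ in atTop, S.eval (n : ℚ) < 0 := by
    rcases le_or_gt S.degree 0 with hd | hd
    · rw [eq_C_of_degree_le_zero hd] at hneg ⊢
      exact Eventually.of_forall fun _ => by simpa using hneg
    · exact ((S.tendsto_atBot_of_leadingCoeff_nonpos hd hneg.le).comp
        tendsto_natCast_atTop_atTop).eventually (eventually_lt_atBot 0)
  obtain ⟨n, h1, h2⟩ := (h.and hev).exists
  exact h1.not_gt h2

theorem Polynomial.coeff_nonneg_of_eventually_eval_nonneg {S : ℚ[X]} {k : ℕ}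
    (hk : S.natDegree ≤ k) (h : ∀ᶠ n : ℕ in atTop, 0 ≤ S.eval (n : ℚ)) : 0 ≤ S.coeff k := by
  rcases hk.eq_or_lt with rfl | hk
  · exact leadingCoeff_nonneg_of_eventually_eval_nonneg h
  · rw [coeff_eq_zero_of_natDegree_lt hk]

theorem binomialBasis_eq (k : ℕ) : binomialBasis k = binomialSequence k :=
  binomialSequence.basis_eq_self _ _

theorem binomialBasis_repr_binomialSequence (k : ℕ) :
    binomialBasis.repr (binomialSequence k) = Finsupp.single k 1 := by
  rw [← binomialBasis_eq, Module.Basis.repr_self]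

theorem binomialBasis_repr_eq_zero {Q : ℚ[X]} {k : ℕ} (h : Q.degree < k) :
    binomialBasis.repr Q k = 0 := by
  have hmem : Q ∈ Submodule.span ℚ (binomialBasis '' Set.Iio k) := by
    have h' : binomialBasis '' Set.Iio k = binomialSequence '' Set.Iio k :=
      Set.image_congr fun i _ => binomialBasis_eq i
    rw [h', binomialSequence.span_degreeLT fun i _ =>
      (leadingCoeff_ne_zero.mpr (binomialSequence.ne_zero i)).isUnit, mem_degreeLT]
    exact h
  by_contra hne
  have := binomialBasis.repr_support_subset_of_mem_span _ hmem (Finsupp.mem_support_iff.mpr hne)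
  exact lt_irrefl k this

theorem binomialSequence_coeff_pos (k : ℕ) : 0 < (binomialSequence k).coeff k := by
  change 0 < (preHilbertPoly ℚ k 0).coeff k
  rw [coeff_preHilbertPoly_self]
  positivity

/-- A polynomial squeezed between `e B_{r+1} + B_r` and `e B_{r+1} + h B_r`, where
`B_k = binom(X + k, k)`. -/
theorem hilbertCoeff_one_neg_of_bounds {P : ℚ[X]} {r : ℕ} {e h : ℚ} (he : 0 < e)
    (hlower : ∀ᶠ n : ℕ in atTop, e * ((n + (r + 1)).choose (r + 1) : ℕ) + ((n + r).choose r : ℕ) ≤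
      P.eval (n : ℚ))
    (hupper : ∀ᶠ n : ℕ in atTop, P.eval (n : ℚ) ≤
      e * ((n + (r + 1)).choose (r + 1) : ℕ) + h * ((n + r).choose r : ℕ)) :
    P.natDegree = r + 1 ∧ hilbertCoeff P 1 < 0 := by
  set Q := P - e • binomialSequence (r + 1) with hQdef
  have hlow : ∀ᶠ n : ℕ in atTop, 0 ≤ (Q - binomialSequence r).eval (n : ℚ) := by
    filter_upwards [hlower] with n hn
    rw [hQdef, eval_sub, eval_sub, eval_smul, binomialSequence_eval, binomialSequence_eval,
      smul_eq_mul]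
    linarith
  have hup : ∀ᶠ n : ℕ in atTop, 0 ≤ (h • binomialSequence r - Q).eval (n : ℚ) := by
    filter_upwards [hupper] with n hn
    rw [hQdef, eval_sub, eval_sub, eval_smul, eval_smul, binomialSequence_eval,
      binomialSequence_eval, smul_eq_mul, smul_eq_mul]
    linarith
  have hB := binomialSequence.degree_eq r
  have hBn := binomialSequence.natDegree_eq r
  -- In degree above `r`, `Q` would dominate both bounds, so that `Q` and `-Q` would both have
  -- nonnegative leading coefficient.
  have hQdeg : Q.natDegree ≤ r := by
    by_contra! hlt
    have hdeg : (r : WithBot ℕ) < Q.degree := by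
      rw [degree_eq_natDegree (by rintro h0; simp [h0] at hlt)]
      exact_mod_cast hlt
    have h1 := leadingCoeff_nonneg_of_eventually_eval_nonneg hlow
    have h2 := leadingCoeff_nonneg_of_eventually_eval_nonneg hup
    rw [leadingCoeff_sub_of_degree_lt (hB.trans_lt hdeg)] at h1
    rw [leadingCoeff_sub_of_degree_lt' ((degree_smul_le _ _).trans_lt (hB.trans_lt hdeg))] at h2
    have hQ0 : Q = 0 := leadingCoeff_eq_zero.mp (by linarith)
    simp [hQ0] at hlt
  have hpos := binomialSequence_coeff_pos r
  have hc : (binomialSequence r).coeff r ≤ Q.coeff r := by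
    have := coeff_nonneg_of_eventually_eval_nonneg (k := r)
      ((natDegree_sub_le _ _).trans (max_le hQdeg hBn.le)) hlow
    rw [coeff_sub] at this
    linarith
  -- `c` is the coordinate of `P` at `B_r`, that is, `-e_1`.
  set c := Q.coeff r / (binomialSequence r).coeff r with hcdef
  have hc0 : 0 < c := div_pos (hpos.trans_le hc) hpos
  have hQ' : (Q - c • binomialSequence r).degree < r := by
    rw [degree_lt_iff_coeff_zero]
    intro m hm
    rcases hm.eq_or_lt with rfl | hm
    · rw [coeff_sub, coeff_smul, smul_eq_mul, hcdef, div_mul_cancel₀ _ hpos.ne', sub_self]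
    · rw [coeff_sub, coeff_smul, coeff_eq_zero_of_natDegree_lt (hQdeg.trans_lt hm),
        coeff_eq_zero_of_natDegree_lt (hBn.trans_lt hm), smul_zero, sub_zero]
  have hP : P = e • binomialSequence (r + 1) + Q := by rw [hQdef]; abel
  have hPdeg : P.natDegree = r + 1 := by
    have hBe : (e • binomialSequence (r + 1)).natDegree = r + 1 := by
      rw [natDegree_smul _ he.ne', binomialSequence.natDegree_eq]
    rw [hP, natDegree_add_eq_left_of_natDegree_lt (by rw [hBe]; lia), hBe]
  refine ⟨hPdeg, ?_⟩
  have hrQ : binomialBasis.repr Q r = c := by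
    have h1 := binomialBasis_repr_eq_zero hQ'
    rw [map_sub, map_smul, binomialBasis_repr_binomialSequence, Finsupp.sub_apply,
      Finsupp.smul_apply, Finsupp.single_eq_same, smul_eq_mul, mul_one, sub_eq_zero] at h1
    exact h1
  have hrP : binomialBasis.repr P r = c := by
    rw [hP, map_add, map_smul, binomialBasis_repr_binomialSequence, Finsupp.add_apply, hrQ,
      Finsupp.smul_apply, Finsupp.single_eq_of_ne (by lia), smul_zero, zero_add]
  rw [hilbertCoeff, hPdeg, if_pos (by lia), Nat.add_sub_cancel, hrP]
  linarith

theorem isHilbertSamuelPolynomial_hilbertSamuelPolynomial {R : Type*} [CommRing R]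
    {M : Type*} [AddCommGroup M] [Module R M] {J : Ideal R}
    (h : ∃ P : ℚ[X], IsHilbertSamuelPolynomial M J P) :
    IsHilbertSamuelPolynomial M J (hilbertSamuelPolynomial M J) := by
  rw [hilbertSamuelPolynomial, dif_pos h]
  exact h.choose_spec

end HilbertCoefficients

/-! ### Assembling the bounds. -/

section Main

open RingTheory.Sequence IsLocalRing

variable {R : Type*} [CommRing R] [IsLocalRing R] {M : Type*} [AddCommGroup M] [Module R M]

theorem length_le_moduleDepth {rs : List R} (hm : ∀ r ∈ rs, r ∈ maximalIdeal R)
    (h : IsRegular M rs) : (rs.length : ℕ∞) ≤ moduleDepth R M :=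
  le_iSup (fun rs : {rs : List R // (∀ r ∈ rs, r ∈ maximalIdeal R) ∧ IsRegular M rs} =>
    (rs.1.length : ℕ∞)) ⟨rs, hm, h⟩

theorem exists_isRegular_length_eq_moduleDepth [Nontrivial M] {r : ℕ}
    (h : moduleDepth R M = r) : ∃ rs : List R, rs.length = r ∧
      (∀ r ∈ rs, r ∈ maximalIdeal R) ∧ IsRegular M rs := by
  -- The empty sequence is regular only because `M ≠ 0`; a finite supremum over a nonempty family in
  -- `ℕ∞` is attained.
  have : Nonempty {rs : List R // (∀ r ∈ rs, r ∈ maximalIdeal R) ∧ IsRegular M rs} :=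
    ⟨[], by simp, IsRegular.nil R M⟩
  obtain ⟨⟨rs, hm, hreg⟩, hrs⟩ := ENat.exists_eq_iSup_of_lt_top
    (f := fun rs : {rs : List R // (∀ r ∈ rs, r ∈ maximalIdeal R) ∧ IsRegular M rs} =>
      (rs.1.length : ℕ∞)) (by
        change moduleDepth R M < ⊤
        rw [h]; exact ENat.natCast_lt_top r)
  refine ⟨rs, ?_, hm, hreg⟩
  have : (rs.length : ℕ∞) = r := hrs.trans h
  exact_mod_cast this

/-- The bounds for `λ(M / J ^ (n + 1) M)` if `J = I + (y)` with `I` generated by a regular sequence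
that is maximal among the regular sequences in the maximal ideal. -/
theorem exists_bounds_length_quotient_pow [IsNoetherianRing R] [Module.Finite R M] {rs : List R}
    {y : R} (hy : y ∈ maximalIdeal R) (hreg : IsWeaklyRegular M rs)
    (hyreg : ¬ IsSMulRegular (M ⧸ (Ideal.ofList rs • ⊤ : Submodule R M)) y)
    (hN : Module.length R (M ⧸ (Ideal.ofList rs • ⊤ : Submodule R M)) = ⊤)
    (hlen : Module.length R (M ⧸ ((Ideal.ofList rs ⊔ Ideal.span {y}) • ⊤ : Submodule R M)) ≠ ⊤) :
    ∃ e h : ℕ, 0 < e ∧ ∀ n,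
      ((e * (n + 1 + rs.length).choose (rs.length + 1) + (n + rs.length).choose rs.length : ℕ) :
        ℕ∞) ≤ Module.length R
          (M ⧸ ((Ideal.ofList rs ⊔ Ideal.span {y}) ^ (n + 1) • ⊤ : Submodule R M)) ∧
      Module.length R
          (M ⧸ ((Ideal.ofList rs ⊔ Ideal.span {y}) ^ (n + 1) • ⊤ : Submodule R M)) ≤
        ((e * (n + 1 + rs.length).choose (rs.length + 1) +
          h * (n + rs.length).choose rs.length : ℕ) : ℕ∞) := by
  set I := Ideal.ofList rs with hI
  have hyJ : y ∈ I ⊔ Ideal.span {y} := Ideal.mem_sup_right (Ideal.mem_span_singleton_self y)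
  have hc : cotorsionLength y (M ⧸ (I • ⊤ : Submodule R M)) ≠ ⊤ := by
    rwa [cotorsionLength_quotient, ← span_singleton_smul_top_eq_range, ← Submodule.sup_smul]
  have hlt := torsionLength_lt_cotorsionLength hc
    (maximalIdeal_le_jacobson ⊥ hy) hN
  obtain ⟨k, hk⟩ := ENat.ne_top_iff_exists.mp (torsionLength_ne_top hc)
  obtain ⟨c, hc'⟩ := ENat.ne_top_iff_exists.mp hc
  rw [← hk, ← hc', Nat.cast_lt] at hlt
  -- This gives `c = k + e + 1`, so the slope is `e + 1`.
  obtain ⟨e, rfl⟩ := Nat.exists_eq_add_of_lt hlt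
  have hk0 : 0 < k := by
    refine Nat.pos_of_ne_zero fun h0 => hyreg ?_
    rw [h0, Nat.cast_zero] at hk
    rw [isSMulRegular_iff_ker_lsmul_eq_bot, ← Submodule.subsingleton_iff_eq_bot,
      ← Module.length_eq_zero_iff (R := R)]
    exact hk.symm
  obtain ⟨h, hh⟩ := exists_length_quotient_range_pow_le hc (e := e + 1)
    (by rw [← hk, ← hc']; push_cast; ring)
  refine ⟨e + 1, h, e.succ_pos, fun n => ⟨?_, ?_⟩⟩
  · exact le_length_quotient_sup_pow (hreg.isGradedPiecePower) hk.symm hk0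
      (by rw [← hc']; push_cast; ring) n
  · have := length_quotient_sup_pow_le_choose (M := M) (J := I ⊔ Ideal.span {y}) rs
      (fun x hx => Ideal.mem_sup_left (Ideal.subset_span hx)) (e + 1) h ⊥ (fun n => by
        refine le_trans ?_ (hh (n + 1))
        rw [bot_sup_eq, ← hI]
        refine Module.length_le_of_surjective (Submodule.liftQ _
          (Submodule.factor (le_sup_left : I • (⊤ : Submodule R M) ≤
            I • ⊤ ⊔ (I ⊔ Ideal.span {y}) ^ (n + 1) • ⊤)) ?_) ?_
        · rintro _ ⟨m, rfl⟩
          obtain ⟨m, rfl⟩ := Submodule.mkQ_surjective _ m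
          rw [LinearMap.mem_ker]
          refine (Submodule.Quotient.mk_eq_zero _ (x := y ^ (n + 1) • m)).mpr ?_
          exact Submodule.mem_sup_right
            (Submodule.smul_mem_smul (Ideal.pow_mem_pow hyJ _) trivial)
        · intro m
          obtain ⟨m, rfl⟩ := Submodule.mkQ_surjective _ m
          exact ⟨Submodule.Quotient.mk (Submodule.Quotient.mk m), rfl⟩) n
    rwa [bot_sup_eq] at this

end Main

theorem mainTheorem9 {R : Type*} [CommRing R] [IsLocalRing R] [IsNoetherianRing R]
    {M : Type*} [AddCommGroup M] [Module R M] [Module.Finite R M] (d : ℕ)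
    (hdim : Module.supportDim R M = d) (hdepth : moduleDepth R M + 1 = d)
    (J : Ideal R) (hJ : IsParameterIdeal R M J) :
    IsHilbertSamuelPolynomial M J (hilbertSamuelPolynomial M J) ∧
      (hilbertSamuelPolynomial M J).natDegree = d ∧
      hilbertSamuelCoeff M J 1 < 0 := by
  obtain ⟨d', x, ⟨hd', hx, hlen⟩, rfl⟩ := hJ
  obtain rfl : d' = d := by
    have := hd'.symm.trans hdim
    exact_mod_cast this
  obtain ⟨r, rfl⟩ : ∃ r, d' = r + 1 := by
    refine Nat.exists_eq_succ_of_ne_zero fun h0 => ?_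
    rw [h0, Nat.cast_zero] at hdepth
    simp at hdepth
  have hdepth' : moduleDepth R M = r := by
    rw [Nat.cast_succ] at hdepth
    exact WithTop.add_right_cancel ENat.one_ne_top hdepth
  have hM : Nontrivial M := by
    rw [← Module.supportDim_ne_bot_iff_nontrivial R, hdim]
    exact WithBot.coe_ne_bot
  set L := List.ofFn x with hL
  have hJL : Ideal.span (Set.range x) = Ideal.ofList L := by
    rw [Ideal.ofList, hL]
    congr 1
    ext z
    exact (List.mem_ofFn' x z).symm
  have hLm : ∀ z ∈ L, z ∈ IsLocalRing.maximalIdeal R := fun z hz => by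
    obtain ⟨i, rfl⟩ := (List.mem_ofFn' _ _).mp hz
    exact hx i
  rw [hJL] at hlen ⊢
  have hspec := isHilbertSamuelPolynomial_hilbertSamuelPolynomial
    (exists_isHilbertSamuelPolynomial (M := M) (Ideal.ofList L) hlen)
  refine ⟨hspec, ?_⟩
  obtain ⟨rs, y, hrs, hreg, hy⟩ := exists_isWeaklyRegular_ofList_eq (by simp [hL]) hLm hlen
    (exists_isRegular_length_eq_moduleDepth hdepth')
  have hJm : Ideal.ofList L ≤ IsLocalRing.maximalIdeal R := Ideal.span_le.mpr hLm
  have hym : y ∈ IsLocalRing.maximalIdeal R :=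
    hJm (hy ▸ Ideal.mem_sup_right (Ideal.mem_span_singleton_self y))
  have hrsm : ∀ z ∈ rs, z ∈ IsLocalRing.maximalIdeal R := fun z hz =>
    hJm (hy ▸ Ideal.mem_sup_left (Ideal.subset_span hz))
  have hregular := (IsLocalRing.isRegular_iff_isWeaklyRegular_of_subset_maximalIdeal hrsm).mpr hreg
  -- Otherwise `rs` followed by `y` would be a regular sequence longer than the depth.
  have hyreg : ¬ IsSMulRegular (M ⧸ (Ideal.ofList rs • ⊤ : Submodule R M)) y := fun hyr => by
    have hm : ∀ z ∈ rs ++ [y], z ∈ IsLocalRing.maximalIdeal R := fun z hz => by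
      rcases List.mem_append.mp hz with hz | hz
      · exact hrsm z hz
      · exact List.mem_singleton.mp hz ▸ hym
    have h := length_le_moduleDepth hm
      ((IsLocalRing.isRegular_iff_isWeaklyRegular_of_subset_maximalIdeal hm).mpr
        ((RingTheory.Sequence.isWeaklyRegular_append_iff M rs [y]).mpr
          ⟨hreg, (RingTheory.Sequence.isWeaklyRegular_singleton_iff _ y).mpr hyr⟩))
    rw [hdepth', List.length_append, hrs, List.length_singleton, Nat.cast_le] at h
    lia
  -- Finite length would force `dim M / (rs) M ≤ 0`, hence `dim M ≤ r`.
  have hN : Module.length R (M ⧸ (Ideal.ofList rs • ⊤ : Submodule R M)) = ⊤ := by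
    by_contra hN
    have h1 := supportDim_le_zero_of_length_ne_top hN
    have h2 := Module.supportDim_add_length_eq_supportDim_of_isRegular rs hregular
    rw [hdim, hrs] at h2
    have h3 := add_le_add_left h1 (r : WithBot ℕ∞)
    rw [h2, zero_add] at h3
    have : r + 1 ≤ r := by exact_mod_cast h3
    lia
  rw [← hy] at hlen
  obtain ⟨e, h, he, hbounds⟩ := exists_bounds_length_quotient_pow hym hreg hyreg hN hlen
  rw [hy, hrs] at hbounds
  refine hilbertCoeff_one_neg_of_bounds (e := e) (h := h) (by exact_mod_cast he) ?_ ?_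
  · filter_upwards [hspec] with n ⟨l, hl, hl'⟩
    have := (hbounds n).1
    rw [hl, Nat.cast_le] at this
    rw [hl', show n + (r + 1) = n + 1 + r by ring]
    exact_mod_cast this
  · filter_upwards [hspec] with n ⟨l, hl, hl'⟩
    have := (hbounds n).2
    rw [hl, Nat.cast_le] at this
    rw [hl', show n + (r + 1) = n + 1 + r by ring]
    exact_mod_cast this
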